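/- Let $q\ge 2$ and $n\ge\max\{\frac{q+23}{2},\frac{5q+19}{q-1}\}$ be integers, and let $\Sigma_q=\{0,1,\dots,q-1\}$. For $x,x'\in\Sigma_q^n$ let $d_H(x,x')$ be their Hamming distance, and let $B^{D,S}_{1,1}(x)\subseteq\Sigma_q^{n-1}$ be the set of all words that can be obtained from $x$ by deleting exactly one symbol and substituting at most one symbol. Let $\delta_{q,2}=1$ if $q=2$ and $\delta_{q,2}=0$ otherwise. Then for all $x,x'\in\Sigma_q^n$ with $d_H(x,x')\ge 2$, $$|B^{D,S}_{1,1}(x)\cap B^{D,S}_{1,1}(x')|\le 2qn-3q-2-\delta_{q,2}.$$ The bound is tight: there exist $x,x'\in\Sigma_q^n$ with $d_H(x,x')=2$ and $$|B^{D,S}_{1,1}(x)\cap B^{D,S}_{1,1}(x')|=2qn-3q-2-\delta_{q,2}.$$ Explicitly, writing $A_m(01)=0101\cdots$ for the alternating word of length $m$ that starts with $0$ and consists of the symbols $0,1$, the pair $x=01201A_{n-5}(01)$, $x'=10201A_{n-5}(01)$ has both properties if $q\ge 3$, and the pair $x=0101A_{n-4}(01)$, $x'=1001A_{n-4}(01)$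 has both properties if $q=2$. -/

import Mathlib

/-- The `t`-deletion `s`-substitution ball of the word `x` of length `n`: the words `y` of length
`n - t` which are obtained from `x` by deleting exactly `t` symbols, so that the subsequence of `x`
at the positions `D 0 < D 1 < ⋯` remains, and by substituting at most `s` symbols. (Substituting
before or after deleting gives the same words.) -/
def delSubBall {α : Type*} [DecidableEq α] {n : ℕ} (t s : ℕ) (x : Fin n → α) :
    Set (Fin (n - t) → α) :=
  {y | ∃ D : Fin (n - t) ↪o Fin n, hammingDist (x ∘ D) y ≤ s}

/-- The alternating word `abab⋯` of length `n`. -/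
def alternating {α : Type*} (a b : α) (n : ℕ) : Fin n → α :=
  fun i => if (i : ℕ) % 2 = 0 then a else b

/-! Cut two words at distance at least two at their first and last difference: `x = p a μ e w` and
`x' = p b ν f w` with `a ≠ b` and `e ≠ f`. A common word `y` lies within one substitution of a
deletion `u` of `x` and of a deletion `u'` of `x'`, so `u` and `u'` differ in at most two places.
What remains depends on where the two letters were deleted (`delSubWords_inter_subset`).

If both deletions fall in `p`, both strictly between the two differences, or both in `w`, the core
differences use up both substitutions. This gives at most `2(n-2)` words, and at most four if `μ ≠
ν`. If the deletion from `x` is the earlier one, `μ e` is shifted against `b ν`. When `μ e ≠ b ν`,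
at most `3q+10` words arise. When `μ e = b ν`, the word `p b ν w` is a deletion of both words, its
whole substitution ball of size `1+(n-1)(q-1)` is common, and at most three further words arise. The
other order is the same with `ν f` against `a μ`.

So the leading term `2qn` arises in two ways. Two balls with `μ ≠ ν` fall short by about `2n`, and
at most one ball by about `(q-1)n`; the hypotheses on `n` absorb the lower-order terms. Two balls
with `μ = ν` force `μ = []`, so the words differ by a swap of adjacent letters, and an exact count
is needed (`card_delSubWords_swap_inter_le`): the two balls share `q` words, and several of the
words with a doubled letter `a a` or `b b` already lie in them. The swap at the very beginning of a
word without repetitions attains the bound. -/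

/-! ### Distances, deletions and substitution balls of lists -/

section Words

variable {α : Type*} [DecidableEq α]

/-- The number of positions at which two words differ (up to the shorter length). -/
def mismatches : List α → List α → ℕ
  | a :: x, b :: y => (if a = b then 0 else 1) + mismatches x y
  | _, _ => 0

/-- The words obtained from a word by deleting exactly one symbol. -/
def deletions : List α → Finset (List α)
  | [] => ∅
  | c :: t => insert t ((deletions t).image (List.cons c))

@[simp] theorem mismatches_nil_left (y : List α) : mismatches [] y = 0 := by
  simp [mismatches]

@[simp] theorem mismatches_nil_right (y : List α) : mismatches y [] = 0 := by
  cases y <;> simp [mismatches]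

@[simp] theorem mismatches_cons (a b : α) (x y : List α) :
    mismatches (a :: x) (b :: y) = (if a = b then 0 else 1) + mismatches x y := by
  simp [mismatches]

@[simp] theorem mismatches_self (x : List α) : mismatches x x = 0 := by
  induction x <;> simp_all

theorem mismatches_comm (x y : List α) : mismatches x y = mismatches y x := by
  induction x generalizing y with
  | nil => simp
  | cons a x ih => cases y <;> simp [ih, eq_comm]

theorem mismatches_append {l l' : List α} (h : l.length = l'.length) (r r' : List α) :
    mismatches (l ++ r) (l' ++ r') = mismatches l l' + mismatches r r' := by
  induction l generalizing l' with
  | nil => cases l' <;> simp_all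
  | cons a l ih => cases l' with
    | nil => simp at h
    | cons b l' => simp [ih (by simpa using h), add_assoc]

theorem mismatches_eq_zero {x y : List α} (h : x.length = y.length) :
    mismatches x y = 0 ↔ x = y := by
  induction x generalizing y with
  | nil => cases y <;> simp_all
  | cons a x ih => cases y with
    | nil => simp at h
    | cons b y => simp [ih (by simpa using h)]

theorem mismatches_triangle {x y z : List α} (h : x.length = y.length)
    (h' : y.length = z.length) : mismatches x z ≤ mismatches x y + mismatches y z := by
  induction x generalizing y z with
  | nil => simp
  | cons a x ih =>
    cases y with
    | nil => simp at h
    | cons b y => cases z with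
      | nil => simp
      | cons c z =>
        have := ih (y := y) (z := z) (by simpa using h) (by simpa using h')
        have hite : (if a = c then 0 else 1) ≤
            (if a = b then 0 else 1) + (if b = c then 0 else 1) := by
          clear this ih
          split_ifs <;> simp_all
        simp only [mismatches_cons]
        omega

theorem mismatches_reverse {x y : List α} (h : x.length = y.length) :
    mismatches x.reverse y.reverse = mismatches x y := by
  induction x generalizing y with
  | nil => simp
  | cons a x ih => cases y with
    | nil => simp
    | cons b y =>
      have h' : x.length = y.length := by simpa using h
      simp [mismatches_append (show x.reverse.length = y.reverse.length by simpa), ih h',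
        add_comm]

theorem mem_deletions {x u : List α} :
    u ∈ deletions x ↔ ∃ l c r, x = l ++ c :: r ∧ u = l ++ r := by
  induction x generalizing u with
  | nil => simp [deletions]
  | cons a x ih =>
    simp only [deletions, Finset.mem_insert, Finset.mem_image, ih]
    constructor
    · rintro (rfl | ⟨_, ⟨l, c, r, rfl, rfl⟩, rfl⟩)
      · exact ⟨[], a, u, rfl, rfl⟩
      · exact ⟨a :: l, c, r, rfl, rfl⟩
    · rintro ⟨l, c, r, h, rfl⟩
      cases l with
      | nil => left; simp_all
      | cons b l =>
        simp only [List.cons_append, List.cons.injEq] at h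
        exact Or.inr ⟨l ++ r, ⟨l, c, r, h.2, rfl⟩, by simp [h.1]⟩

theorem mem_deletions_append {x y u : List α} : u ∈ deletions (x ++ y) ↔
    (∃ v ∈ deletions x, u = v ++ y) ∨ ∃ v ∈ deletions y, u = x ++ v := by
  induction x generalizing u with
  | nil => simp [deletions]
  | cons a x ih =>
    simp only [List.cons_append, deletions, Finset.mem_insert, Finset.mem_image, ih]
    constructor
    · rintro (rfl | ⟨_, ⟨v, hv, rfl⟩ | ⟨v, hv, rfl⟩, rfl⟩)
      · exact Or.inl ⟨x, Or.inl rfl, rfl⟩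
      · exact Or.inl ⟨a :: v, Or.inr ⟨v, hv, rfl⟩, rfl⟩
      · exact Or.inr ⟨v, hv, rfl⟩
    · rintro (⟨v, rfl | ⟨v', hv', rfl⟩, rfl⟩ | ⟨v, hv, rfl⟩)
      · exact Or.inl rfl
      · exact Or.inr ⟨_, Or.inl ⟨v', hv', rfl⟩, rfl⟩
      · exact Or.inr ⟨_, Or.inr ⟨v, hv, rfl⟩, rfl⟩

theorem length_of_mem_deletions {x u : List α} (h : u ∈ deletions x) :
    u.length + 1 = x.length := by
  obtain ⟨l, c, r, rfl, rfl⟩ := mem_deletions.1 h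
  simp [add_assoc]

theorem reverse_mem_deletions {x u : List α} (h : u ∈ deletions x) :
    u.reverse ∈ deletions x.reverse := by
  obtain ⟨l, c, r, rfl, rfl⟩ := mem_deletions.1 h
  exact mem_deletions.2 ⟨r.reverse, c, l.reverse, by simp, by simp⟩

theorem mem_deletions_iff_sublist {x u : List α} :
    u ∈ deletions x ↔ u.Sublist x ∧ u.length + 1 = x.length := by
  refine ⟨fun h => ⟨?_, length_of_mem_deletions h⟩, fun h => ?_⟩
  · obtain ⟨l, c, r, rfl, rfl⟩ := mem_deletions.1 h
    simp
  · obtain ⟨h, hl⟩ := h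
    induction h with
    | slnil => simp at hl
    | cons a h ih =>
      rw [h.eq_of_length (by simpa using hl)]
      simp [deletions]
    | cons_cons a h ih =>
      simp only [deletions, Finset.mem_insert, Finset.mem_image]
      exact Or.inr ⟨_, ih (Nat.succ.inj hl), rfl⟩

theorem card_deletions_le (x : List α) : (deletions x).card ≤ x.length := by
  induction x with
  | nil => simp [deletions]
  | cons a x ih =>
    have := Finset.card_insert_le x ((deletions x).image (List.cons a))
    have := Finset.card_image_le (s := deletions x) (f := List.cons a)
    simp only [deletions, List.length_cons]
    omega

/-- A deletion of `c :: t` is determined by its distance from `t`. -/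
theorem deletions_mismatches_inj {c : α} {t u v : List α} (hu : u ∈ deletions (c :: t))
    (hv : v ∈ deletions (c :: t)) (h : mismatches u t = mismatches v t) : u = v := by
  induction t generalizing c u v with
  | nil => simp_all [deletions]
  | cons b t ih =>
    -- If `c = b`, deleting the head equals deleting the next letter, so deletions that drop the
    -- head need separate treatment only when `c ≠ b`. Then `b :: t` has distance zero from the
    -- tail, while every deletion keeping `c` already differs in the first place.
    have key : ∀ u ∈ deletions (c :: b :: t), (c ≠ b ∧ u = b :: t) ∨
        ∃ u' ∈ deletions (b :: t), u = c :: u' := by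
      intro u hu
      rw [deletions, Finset.mem_insert, Finset.mem_image] at hu
      rcases hu with rfl | ⟨u', hu', rfl⟩
      · by_cases hcb : c = b
        · exact Or.inr ⟨t, by simp [deletions], by rw [hcb]⟩
        · exact Or.inl ⟨hcb, rfl⟩
      · exact Or.inr ⟨u', hu', rfl⟩
    rcases key u hu with ⟨hc, rfl⟩ | ⟨u', hu', rfl⟩ <;>
      rcases key v hv with ⟨hc', rfl⟩ | ⟨v', hv', rfl⟩
    · rfl
    · simp [hc] at h
      omega
    · simp [hc'] at h
    · simp only [mismatches_cons] at h
      rw [ih hu' hv' (by omega)]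

theorem deletions_append_mismatches_inj {c : α} {t u v : List α} (hu : u ∈ deletions (t ++ [c]))
    (hv : v ∈ deletions (t ++ [c])) (h : mismatches u t = mismatches v t) : u = v := by
  have hu' := length_of_mem_deletions hu
  have hv' := length_of_mem_deletions hv
  simp only [List.length_append, List.length_cons, List.length_nil] at hu' hv'
  apply List.reverse_injective
  refine deletions_mismatches_inj (c := c) (t := t.reverse) ?_ ?_ ?_
  · simpa using reverse_mem_deletions hu
  · simpa using reverse_mem_deletions hv
  · rw [mismatches_reverse (by omega), mismatches_reverse (by omega), h]

theorem card_deletions_filter_mismatches_le_one (c : α) (t : List α) (k : ℕ) :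
    ((deletions (c :: t)).filter (fun u => mismatches u t = k)).card ≤ 1 := by
  refine Finset.card_le_one.2 fun u hu v hv => ?_
  rw [Finset.mem_filter] at hu hv
  exact deletions_mismatches_inj hu.1 hv.1 (hu.2.trans hv.2.symm)

theorem card_deletions_append_filter_mismatches_le_one (c : α) (t : List α) (k : ℕ) :
    ((deletions (t ++ [c])).filter (fun u => mismatches u t = k)).card ≤ 1 := by
  refine Finset.card_le_one.2 fun u hu v hv => ?_
  rw [Finset.mem_filter] at hu hv
  exact deletions_append_mismatches_inj hu.1 hv.1 (hu.2.trans hv.2.symm)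

/-- By the triangle inequality the distance of such a deletion from the tail of `x` differs by at
most one from that of `z`. It takes at most three values, and each value determines the deletion. -/
theorem card_deletions_filter_near_le_three (x : List α) {z : List α}
    (hz : z.length + 1 = x.length) :
    ((deletions x).filter (fun u => mismatches z u ≤ 1)).card ≤ 3 := by
  cases x with
  | nil => simp at hz
  | cons c t =>
    have hzt : z.length = t.length := by simpa using hz
    rw [← Finset.card_image_of_injOn (f := fun u => mismatches u t)]
    · refine (Finset.card_le_card (t := Finset.Icc (mismatches z t - 1) (mismatches z t + 1))
        ?_).trans (by simp; omega)
      intro k hk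
      simp only [Finset.mem_image, Finset.mem_filter] at hk
      obtain ⟨u, ⟨hu, hzu⟩, rfl⟩ := hk
      have hul := length_of_mem_deletions hu
      have h1 := mismatches_triangle (x := z) (y := u) (z := t) (by omega) (by omega)
      have h2 := mismatches_triangle (x := u) (y := z) (z := t) (by omega) (by omega)
      rw [mismatches_comm u z] at h2
      rw [Finset.mem_Icc]
      omega
    · intro u hu v hv h
      simp only [Finset.coe_filter, Set.mem_ofPred_eq] at hu hv
      exact deletions_mismatches_inj hu.1 hv.1 h

/-- A common first letter can be stripped. Once the first letters differ, a common deletion cannot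
keep both heads, so it is one of the two tails. -/
theorem card_deletions_inter_le_two {x x' : List α} (h : x ≠ x') :
    (deletions x ∩ deletions x').card ≤ 2 := by
  induction x generalizing x' with
  | nil => simp [deletions]
  | cons a x ih =>
    cases x' with
    | nil => simp [deletions]
    | cons b x' =>
      by_cases hab : a = b
      · subst hab
        have hx : x ≠ x' := by simpa using h
        refine (Finset.card_le_card (t := (deletions x ∩ deletions x').image (List.cons a))
          ?_).trans (Finset.card_image_le.trans (ih hx))
        intro u hu
        have hl := length_of_mem_deletions (Finset.mem_inter.1 hu).1
        simp only [deletions, Finset.mem_inter, Finset.mem_insert, Finset.mem_image] at hu ⊢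
        have aux : ∀ {y z : List α}, a :: y = z → y ∈ deletions z := by
          rintro y z rfl
          simp [deletions]
        rcases hu with ⟨rfl | ⟨v, hv, rfl⟩, h1 | ⟨v', hv', h2⟩⟩
        · exact absurd h1 hx
        · exact ⟨v', ⟨aux h2, hv'⟩, h2⟩
        · exact ⟨v, ⟨hv, aux h1⟩, rfl⟩
        · exact ⟨v, ⟨hv, by simp_all⟩, rfl⟩
      · refine (Finset.card_le_card (t := {x, x'}) ?_).trans Finset.card_le_two
        intro u hu
        simp only [deletions, Finset.mem_inter, Finset.mem_insert, Finset.mem_image,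
          Finset.mem_singleton] at hu ⊢
        rcases hu with ⟨rfl | ⟨v, hv, rfl⟩, h1 | ⟨v', hv', h2⟩⟩ <;> simp_all

/-- Deleting the head repeats another deletion only if the next letter equals the head. -/
theorem card_deletions_of_isChain {x : List α} (h : x.IsChain (· ≠ ·)) :
    (deletions x).card = x.length := by
  induction x with
  | nil => simp [deletions]
  | cons a x ih =>
    rw [deletions, Finset.card_insert_of_notMem, Finset.card_image_of_injective _
      (List.cons_injective), ih h.tail, List.length_cons]
    intro hx
    rw [Finset.mem_image] at hx
    obtain ⟨v, hv, rfl⟩ := hx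
    simp at h

/-! ### Substitution balls and their intersections -/

variable [Fintype α]

/-- The words of the same length that differ from a given word in at most one position. -/
def substitutions : List α → Finset (List α)
  | [] => {[]}
  | c :: t => (substitutions t).image (List.cons c) ∪ Finset.univ.image (fun g => g :: t)

theorem mem_substitutions {u y : List α} :
    y ∈ substitutions u ↔ u.length = y.length ∧ mismatches u y ≤ 1 := by
  induction u generalizing y with
  | nil => simp [substitutions, eq_comm]
  | cons a u ih =>
    simp only [substitutions, Finset.mem_union, Finset.mem_image, ih, Finset.mem_univ, true_and]
    constructor
    · rintro (⟨v, ⟨h1, h2⟩, rfl⟩ | ⟨g, rfl⟩)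
      · simp [h1, h2]
      · simp
        split_ifs <;> simp
    · rintro ⟨h1, h2⟩
      cases y with
      | nil => simp at h1
      | cons b y =>
        simp only [List.length_cons, Nat.add_right_cancel_iff] at h1
        by_cases hab : a = b
        · subst hab
          simp at h2
          exact Or.inl ⟨y, ⟨h1, h2⟩, rfl⟩
        · simp [hab] at h2
          exact Or.inr ⟨b, by rw [(mismatches_eq_zero h1).1 h2]⟩

theorem card_substitutions (u : List α) :
    (substitutions u).card = 1 + u.length * (Fintype.card α - 1) := by
  induction u with
  | nil => simp [substitutions]
  | cons a u ih =>
    have h : substitutions (a :: u) = (substitutions u).image (List.cons a) ∪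
        (Finset.univ.erase a).image (fun g => g :: u) := by
      ext y
      simp only [substitutions, Finset.mem_union, Finset.mem_image, Finset.mem_univ, true_and,
        Finset.mem_erase, and_true]
      constructor
      · rintro (h | ⟨g, rfl⟩)
        · exact Or.inl h
        · by_cases hg : g = a
          · subst hg
            exact Or.inl ⟨u, by simp [mem_substitutions], rfl⟩
          · exact Or.inr ⟨g, hg, rfl⟩
      · rintro (h | ⟨g, -, rfl⟩)
        · exact Or.inl h
        · exact Or.inr ⟨g, rfl⟩
    rw [h, Finset.card_union_of_disjoint, Finset.card_image_of_injective _ List.cons_injective,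
      Finset.card_image_of_injective, ih, Finset.card_erase_of_mem (Finset.mem_univ a),
      Finset.card_univ, List.length_cons]
    · ring
    · intro g g' hg
      simpa using hg
    · rw [Finset.disjoint_left]
      intro y hy hy'
      simp only [Finset.mem_image, Finset.mem_erase] at hy hy'
      obtain ⟨v, -, rfl⟩ := hy
      obtain ⟨g, hg, hg'⟩ := hy'
      simp_all

theorem mem_substitutions_inter_cons {a b : α} {u v y : List α} (hab : a ≠ b)
    (h : u.length = v.length)
    (hy : y ∈ substitutions (a :: u) ∩ substitutions (b :: v)) :
    y = a :: v ∨ y = b :: u ∨ u = v ∧ ∃ g, y = g :: u := by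
  rw [Finset.mem_inter, mem_substitutions, mem_substitutions] at hy
  obtain ⟨⟨hl, h1⟩, -, h2⟩ := hy
  cases y with
  | nil => simp at hl
  | cons g y =>
    simp only [List.length_cons, Nat.add_right_cancel_iff] at hl
    simp only [mismatches_cons] at h1 h2
    by_cases ha : a = g
    · subst ha
      rw [if_neg hab.symm] at h2
      left
      rw [(mismatches_eq_zero (h.symm.trans hl)).1 (by omega)]
    · rw [if_neg ha] at h1
      have hu := (mismatches_eq_zero hl).1 (by omega)
      subst hu
      by_cases hb : b = g
      · simp [hb]
      · rw [if_neg hb] at h2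
        have hv := (mismatches_eq_zero (h.symm.trans hl)).1 (by omega)
        exact Or.inr (Or.inr ⟨hv.symm, g, rfl⟩)

theorem substitutions_inter_cons_subset {a : α} {u v : List α} (h : u.length = v.length)
    (huv : u ≠ v) : substitutions (a :: u) ∩ substitutions (a :: v) ⊆
      (substitutions u ∩ substitutions v).image (List.cons a) := by
  intro y hy
  rw [Finset.mem_inter, mem_substitutions, mem_substitutions] at hy
  obtain ⟨⟨hl, h1⟩, -, h2⟩ := hy
  cases y with
  | nil => simp at hl
  | cons g y =>
    simp only [List.length_cons, Nat.add_right_cancel_iff] at hl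
    simp only [mismatches_cons] at h1 h2
    simp only [Finset.mem_image, Finset.mem_inter, mem_substitutions]
    by_cases ha : a = g
    · subst ha
      exact ⟨y, ⟨⟨hl, by omega⟩, h.symm.trans hl, by omega⟩, rfl⟩
    · rw [if_neg ha] at h1 h2
      exact absurd (((mismatches_eq_zero hl).1 (by omega)).trans
        ((mismatches_eq_zero (h.symm.trans hl)).1 (by omega)).symm) huv

/-- Centres that differ in one place share the `q` words on the line through them; centres further
apart share at most two words. -/
theorem card_substitutions_inter_le (hq : 2 ≤ Fintype.card α) {u v : List α}
    (h : u.length = v.length) (huv : u ≠ v) :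
    (substitutions u ∩ substitutions v).card ≤ Fintype.card α := by
  induction u generalizing v with
  | nil => cases v <;> simp_all
  | cons a u ih =>
    cases v with
    | nil => simp at h
    | cons b v =>
      have hl : u.length = v.length := by simpa using h
      by_cases hab : a = b
      · subst hab
        have hne : u ≠ v := by simpa using huv
        exact (Finset.card_le_card (substitutions_inter_cons_subset hl hne)).trans
          (Finset.card_image_le.trans (ih hl hne))
      · by_cases hne : u = v
        · subst hne
          refine (Finset.card_le_card (t := Finset.univ.image (fun g => g :: u)) ?_).trans
            (Finset.card_image_le.trans (by simp))
          intro y hy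
          rw [Finset.mem_image]
          rcases mem_substitutions_inter_cons hab hl hy with rfl | rfl | ⟨-, g, rfl⟩ <;> simp
        · refine (Finset.card_le_card (t := {a :: v, b :: u}) ?_).trans
            (Finset.card_le_two.trans hq)
          intro y hy
          rcases mem_substitutions_inter_cons hab hl hy with rfl | rfl | ⟨h, -⟩
          · simp
          · simp
          · exact absurd h hne

theorem card_substitutions_inter_le_two {u v : List α}
    (h : u.length = v.length) (huv : 2 ≤ mismatches u v) :
    (substitutions u ∩ substitutions v).card ≤ 2 := by
  induction u generalizing v with
  | nil => simp at huv
  | cons a u ih =>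
    cases v with
    | nil => simp at h
    | cons b v =>
      have hl : u.length = v.length := by simpa using h
      have hne : u ≠ v := by
        rintro rfl
        simp at huv
        split_ifs at huv <;> omega
      by_cases hab : a = b
      · subst hab
        exact (Finset.card_le_card (substitutions_inter_cons_subset hl hne)).trans
          (Finset.card_image_le.trans (ih hl (by simpa using huv)))
      · refine (Finset.card_le_card (t := {a :: v, b :: u}) ?_).trans Finset.card_le_two
        intro y hy
        rcases mem_substitutions_inter_cons hab hl hy with rfl | rfl | ⟨h, -⟩
        · simp
        · simp
        · exact absurd h hne

theorem substitutions_inter_eq_empty {u v : List α} (huv : 3 ≤ mismatches u v) :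
    substitutions u ∩ substitutions v = ∅ := by
  refine Finset.eq_empty_of_forall_notMem fun y hy => ?_
  rw [Finset.mem_inter, mem_substitutions, mem_substitutions] at hy
  have := mismatches_triangle (x := u) (y := y) (z := v) (by omega) (by omega)
  rw [mismatches_comm y v] at this
  omega

end Words

/-! ### Covering the common words according to the places of the two deletions -/

section Cover

theorem exists_eq_append_of_length {α : Type*} {y : List α} {m n : ℕ} (h : m + n = y.length) :
    ∃ l r, y = l ++ r ∧ m = l.length ∧ n = r.length :=
  ⟨y.take m, y.drop m, by simp, by simp; omega, by simp; omega⟩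

variable {α : Type*} [DecidableEq α]

/-- The deletions of `p ++ [a]` at distance exactly one from `p`. -/
def prefixShifts (p : List α) (a : α) : Finset (List α) :=
  (deletions (p ++ [a])).filter (fun u => mismatches u p = 1)

/-- The deletions of `f :: w` at distance exactly one from `w`. -/
def suffixShifts (f : α) (w : List α) : Finset (List α) :=
  (deletions (f :: w)).filter (fun u => mismatches u w = 1)

theorem mem_prefixShifts {p u : List α} {a : α} :
    u ∈ prefixShifts p a ↔ u ∈ deletions (p ++ [a]) ∧ mismatches u p = 1 := by
  simp [prefixShifts]

theorem mem_suffixShifts {w u : List α} {f : α} :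
    u ∈ suffixShifts f w ↔ u ∈ deletions (f :: w) ∧ mismatches u w = 1 := by
  simp [suffixShifts]

theorem card_prefixShifts_le_one (p : List α) (a : α) : (prefixShifts p a).card ≤ 1 :=
  card_deletions_append_filter_mismatches_le_one a p 1

theorem card_suffixShifts_le_one (f : α) (w : List α) : (suffixShifts f w).card ≤ 1 :=
  card_deletions_filter_mismatches_le_one f w 1

theorem two_le_mismatches_core {μ ν : List α} {a b e f : α} (hab : a ≠ b) (hef : e ≠ f)
    (hl : μ.length = ν.length) : 2 ≤ mismatches (a :: (μ ++ [e])) (b :: (ν ++ [f])) := by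
  simp [mismatches_append hl, hab, hef]
  omega

theorem deletions_cases {p μ w u : List α} {a e : α}
    (h : u ∈ deletions (p ++ a :: (μ ++ e :: w))) :
    (∃ π ∈ deletions (p ++ [a]), u = π ++ (μ ++ e :: w)) ∨
      (∃ v ∈ deletions μ, u = p ++ (a :: (v ++ e :: w))) ∨
      ∃ ω ∈ deletions (e :: w), u = p ++ (a :: (μ ++ ω)) := by
  have r : p ++ a :: (μ ++ e :: w) = (p ++ [a]) ++ (μ ++ e :: w) := by simp
  rw [r, mem_deletions_append] at h
  rcases h with ⟨π, hπ, rfl⟩ | ⟨v, hv, rfl⟩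
  · exact Or.inl ⟨π, hπ, rfl⟩
  · rcases mem_deletions_append.1 hv with ⟨v, hv', rfl⟩ | ⟨ω, hω, rfl⟩
    · exact Or.inr (Or.inl ⟨v, hv', by simp⟩)
    · exact Or.inr (Or.inr ⟨ω, hω, by simp⟩)

variable [Fintype α]

/-- The words obtained by one deletion and at most one substitution. -/
def delSubWords (x : List α) : Finset (List α) :=
  (deletions x).biUnion substitutions

theorem mem_delSubWords {x y : List α} :
    y ∈ delSubWords x ↔ ∃ u ∈ deletions x, y ∈ substitutions u := by
  simp [delSubWords]

/-- The words close to `π μ e w` and `p z f w`, for `π ∈ D(p a)` and `z ∈ D(b ν)`. -/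
def leftWords (p : List α) (a : α) (μ : List α) (e b : α) (ν : List α) (f : α) (w : List α) :
    Finset (List α) :=
  ((deletions (b :: ν)).filter (fun z => mismatches μ z ≤ 1)).image (fun z => p ++ (z ++ e :: w)) ∪
    Finset.univ.image (fun g => p ++ (μ ++ g :: w)) ∪
    (prefixShifts p a).image (fun π => π ++ (μ ++ f :: w))

/-- The words close to `p a z w` and `p b ν ω`, for `z ∈ D(μ e)` and `ω ∈ D(f w)`. -/
def rightWords (p : List α) (a : α) (μ : List α) (e b : α) (ν : List α) (f : α) (w : List α) :
    Finset (List α) :=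
  ((deletions (μ ++ [e])).filter (fun z => mismatches ν z ≤ 1)).image
      (fun z => p ++ (b :: (z ++ w))) ∪
    Finset.univ.image (fun g => p ++ (g :: (ν ++ w))) ∪
    (suffixShifts f w).image (fun ω => p ++ (a :: (ν ++ ω)))

/-- The exceptional words close to `π μ e w` and `p b ν ω`, for `π ∈ D(p a)` and `ω ∈ D(f w)`. -/
def cornerWords (p : List α) (a : α) (μ : List α) (e b : α) (ν : List α) (f : α) (w : List α) :
    Finset (List α) :=
  if μ ++ [e] = b :: ν then
    ((prefixShifts p a) ×ˢ (suffixShifts f w)).image (fun t => t.1 ++ (b :: (ν ++ t.2)))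
  else
    (prefixShifts p a).image (fun π => π ++ (b :: (ν ++ w))) ∪
      (suffixShifts f w).image (fun ω => p ++ (μ ++ e :: ω))

/-- The position where `e` faces `f` costs one of the two words its substitution. If `y` has `e`
there, the second word is otherwise exact. If not, the first word is otherwise exact, and either `π
= p` or the second word spends its substitution inside `p`, which forces the letter `f`. -/
theorem mem_leftWords {p μ ν w π z y : List α} {a b e f : α} (hef : e ≠ f)
    (hl : μ.length = ν.length) (hπ : π ∈ deletions (p ++ [a])) (hz : z ∈ deletions (b :: ν))
    (h1 : y ∈ substitutions (π ++ (μ ++ e :: w))) (h2 : y ∈ substitutions (p ++ (z ++ f :: w))) :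
    y ∈ leftWords p a μ e b ν f w := by
  have hπl := length_of_mem_deletions hπ
  have hzl := length_of_mem_deletions hz
  simp only [List.length_append, List.length_cons, List.length_nil] at hπl hzl
  rw [mem_substitutions] at h1 h2
  obtain ⟨hy, h1⟩ := h1
  obtain ⟨-, h2⟩ := h2
  simp only [List.length_append] at hy
  obtain ⟨yp, y', rfl, hyp, hy'⟩ := exists_eq_append_of_length hy
  obtain ⟨ym, y'', rfl, hym, hy''⟩ := exists_eq_append_of_length hy'
  cases y'' with
  | nil => simp at hy''
  | cons g yw =>
  simp only [List.length_cons, Nat.add_right_cancel_iff] at hy''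
  rw [mismatches_append (by omega), mismatches_append (by omega), mismatches_cons] at h1 h2
  have e1 := mismatches_eq_zero (x := π) (y := yp) (by omega)
  have e2 := mismatches_eq_zero (x := p) (y := yp) (by omega)
  have e3 := mismatches_eq_zero (x := μ) (y := ym) (by omega)
  have e4 := mismatches_eq_zero (x := z) (y := ym) (by omega)
  have e5 := mismatches_eq_zero (x := w) (y := yw) (by omega)
  simp only [leftWords, Finset.mem_union, Finset.mem_image, Finset.mem_filter, Finset.mem_univ,
    true_and, mem_prefixShifts]
  by_cases he : e = g
  · subst he
    rw [if_neg hef.symm] at h2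
    obtain rfl := e2.1 (by omega)
    obtain rfl := e4.1 (by omega)
    obtain rfl := e5.1 (by omega)
    exact Or.inl (Or.inl ⟨z, ⟨hz, by omega⟩, rfl⟩)
  · rw [if_neg he] at h1
    obtain rfl := e1.1 (by omega)
    obtain rfl := e3.1 (by omega)
    obtain rfl := e5.1 (by omega)
    by_cases hp : mismatches p π = 0
    · rw [e2.1 hp]
      exact Or.inl (Or.inr ⟨g, rfl⟩)
    · have hf : f = g := by
        by_contra hf
        rw [if_neg hf] at h2
        omega
      subst hf
      exact Or.inr ⟨π, ⟨hπ, by rw [mismatches_comm]; omega⟩, rfl⟩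

/-- Mirror image of `mem_leftWords`: here the letters `a` and `b` face each other and the shift may
happen in `w`. -/
theorem mem_rightWords {p μ ν w ω z y : List α} {a b e f : α} (hab : a ≠ b)
    (hl : μ.length = ν.length) (hω : ω ∈ deletions (f :: w)) (hz : z ∈ deletions (μ ++ [e]))
    (h1 : y ∈ substitutions (p ++ (a :: (z ++ w)))) (h2 : y ∈ substitutions (p ++ (b :: (ν ++ ω)))) :
    y ∈ rightWords p a μ e b ν f w := by
  have hωl := length_of_mem_deletions hω
  have hzl := length_of_mem_deletions hz
  simp only [List.length_append, List.length_cons, List.length_nil] at hωl hzl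
  rw [mem_substitutions] at h1 h2
  obtain ⟨hy, h1⟩ := h1
  obtain ⟨-, h2⟩ := h2
  rw [List.length_append] at hy
  obtain ⟨yp, y', rfl, hyp, hy'⟩ := exists_eq_append_of_length hy
  cases y' with
  | nil => simp at hy'
  | cons g y'' =>
  simp only [List.length_cons, Nat.add_right_cancel_iff, List.length_append] at hy'
  obtain ⟨ym, yw, rfl, hym, hyw⟩ := exists_eq_append_of_length hy'
  rw [mismatches_append (by omega), mismatches_cons, mismatches_append (by omega)] at h1 h2
  have e1 := mismatches_eq_zero (x := ω) (y := yw) (by omega)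
  have e2 := mismatches_eq_zero (x := w) (y := yw) (by omega)
  have e3 := mismatches_eq_zero (x := ν) (y := ym) (by omega)
  have e4 := mismatches_eq_zero (x := z) (y := ym) (by omega)
  have e5 := mismatches_eq_zero (x := p) (y := yp) (by omega)
  simp only [rightWords, Finset.mem_union, Finset.mem_image, Finset.mem_filter, Finset.mem_univ,
    true_and, mem_suffixShifts]
  by_cases he : b = g
  · subst he
    rw [if_neg hab] at h1
    obtain rfl := e2.1 (by omega)
    obtain rfl := e4.1 (by omega)
    obtain rfl := e5.1 (by omega)
    exact Or.inl (Or.inl ⟨z, ⟨hz, by omega⟩, rfl⟩)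
  · rw [if_neg he] at h2
    obtain rfl := e1.1 (by omega)
    obtain rfl := e3.1 (by omega)
    obtain rfl := e5.1 (by omega)
    by_cases hp : mismatches w ω = 0
    · rw [e2.1 hp]
      exact Or.inl (Or.inr ⟨g, rfl⟩)
    · have hf : a = g := by
        by_contra hf
        rw [if_neg hf] at h1
        omega
      subst hf
      exact Or.inr ⟨ω, ⟨hω, by rw [mismatches_comm]; omega⟩, rfl⟩

/-- With `s = μ e` and `t = b ν`, the words compared are `π s w` and `p t ω`. If `y` is not close to
both `p s w` and `p t w`, counting mismatches block by block fixes it: as `π s ω` with a shift on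
both sides if `s = t`, and as `π t w` or `p s ω` if `s ≠ t`. -/
theorem mem_cornerWords {p μ ν w π ω y : List α} {a b e f : α}
    (hl : μ.length = ν.length) (hπ : π ∈ deletions (p ++ [a])) (hω : ω ∈ deletions (f :: w))
    (h1 : y ∈ substitutions (π ++ (μ ++ e :: w))) (h2 : y ∈ substitutions (p ++ (b :: (ν ++ ω)))) :
    y ∈ (substitutions (p ++ (μ ++ e :: w)) ∩ substitutions (p ++ (b :: (ν ++ w)))) ∪
      cornerWords p a μ e b ν f w := by
  have hπl := length_of_mem_deletions hπ
  have hωl := length_of_mem_deletions hω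
  simp only [List.length_append, List.length_cons, List.length_nil] at hπl hωl
  have r1 : μ ++ e :: w = (μ ++ [e]) ++ w := by simp
  have r1' : (fun t : List α => p ++ (μ ++ e :: t)) = fun t => p ++ ((μ ++ [e]) ++ t) := by simp
  have r2 : ∀ t : List α, b :: (ν ++ t) = (b :: ν) ++ t := by simp
  rw [Finset.mem_union, Finset.mem_inter]
  rw [cornerWords, r1', r1]
  rw [r1] at h1
  simp only [r2] at h2 ⊢
  have hst : (μ ++ [e]).length = (b :: ν).length := by simp [hl]
  generalize μ ++ [e] = s at *
  generalize b :: ν = t at *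
  rw [mem_substitutions] at h1 h2 ⊢
  rw [mem_substitutions]
  obtain ⟨hy, h1⟩ := h1
  obtain ⟨-, h2⟩ := h2
  rw [List.length_append] at hy
  obtain ⟨yp, y', rfl, hyp, hy'⟩ := exists_eq_append_of_length hy
  rw [List.length_append] at hy'
  obtain ⟨ym, yw, rfl, hym, hyw⟩ := exists_eq_append_of_length hy'
  simp only [List.length_append]
  rw [mismatches_append (by omega), mismatches_append (by omega)] at h1 h2 ⊢
  rw [mismatches_append (by omega), mismatches_append (by omega)]
  have e1 := mismatches_eq_zero (x := ω) (y := yw) (by omega)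
  have e2 := mismatches_eq_zero (x := w) (y := yw) (by omega)
  have e3 := mismatches_eq_zero (x := s) (y := ym) (by omega)
  have e4 := mismatches_eq_zero (x := t) (y := ym) (by omega)
  have e5 := mismatches_eq_zero (x := p) (y := yp) (by omega)
  have e6 := mismatches_eq_zero (x := π) (y := yp) (by omega)
  by_cases hc : (p.length + (s.length + w.length) = yp.length + (ym.length + yw.length) ∧
      mismatches p yp + (mismatches s ym + mismatches w yw) ≤ 1) ∧
      p.length + (t.length + w.length) = yp.length + (ym.length + yw.length) ∧
      mismatches p yp + (mismatches t ym + mismatches w yw) ≤ 1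
  · exact Or.inl hc
  right
  have h1' : ¬ (mismatches p yp + (mismatches s ym + mismatches w yw) ≤ 1 ∧
      mismatches p yp + (mismatches t ym + mismatches w yw) ≤ 1) :=
    fun h => hc ⟨⟨by omega, h.1⟩, by omega, h.2⟩
  split_ifs with hs
  · subst hs
    obtain rfl := e6.1 (by omega)
    obtain rfl := e1.1 (by omega)
    obtain rfl := e3.1 (by omega)
    refine Finset.mem_image.2 ⟨(π, ω), ?_, rfl⟩
    rw [Finset.mem_product, mem_prefixShifts, mem_suffixShifts, mismatches_comm π,
      mismatches_comm ω]
    exact ⟨⟨hπ, by omega⟩, hω, by omega⟩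
  · have hs' : ¬ (mismatches s ym = 0 ∧ mismatches t ym = 0) :=
      fun h => hs ((e3.1 h.1).trans (e4.1 h.2).symm)
    rw [Finset.mem_union, Finset.mem_image, Finset.mem_image]
    by_cases hw : mismatches w yw = 0
    · left
      obtain rfl := e6.1 (by omega)
      obtain rfl := e2.1 hw
      obtain rfl := e4.1 (by omega)
      exact ⟨π, mem_prefixShifts.2 ⟨hπ, by rw [mismatches_comm]; omega⟩, rfl⟩
    · right
      obtain rfl := e5.1 (by omega)
      obtain rfl := e1.1 (by omega)
      obtain rfl := e3.1 (by omega)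
      exact ⟨ω, mem_suffixShifts.2 ⟨hω, by rw [mismatches_comm]; omega⟩, rfl⟩

/-- The words reached from `p a μ e w` by a deletion not later than that from `p b ν f w`,
where the two deletions are separated by one of the differing positions. -/
def crossWords (p : List α) (a : α) (μ : List α) (e b : α) (ν : List α) (f : α) (w : List α) :
    Finset (List α) :=
  leftWords p a μ e b ν f w ∪ rightWords p a μ e b ν f w ∪
    ((substitutions (p ++ (μ ++ e :: w)) ∩ substitutions (p ++ (b :: (ν ++ w)))) ∪
      cornerWords p a μ e b ν f w)

/-- The words reached from `p a μ e w` and `p b ν f w` by deletions in the same segment. -/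
def parallelWords (p : List α) (a : α) (μ : List α) (e b : α) (ν : List α) (f : α) (w : List α) :
    Finset (List α) :=
  (deletions p ×ˢ (substitutions (a :: (μ ++ [e])) ∩ substitutions (b :: (ν ++ [f])))).image
      (fun t => t.1 ++ (t.2 ++ w)) ∪
    (deletions w ×ˢ (substitutions (a :: (μ ++ [e])) ∩ substitutions (b :: (ν ++ [f])))).image
      (fun t => p ++ (t.2 ++ t.1)) ∪
    ((deletions μ ∩ deletions ν).image (fun v => p ++ (a :: (v ++ f :: w))) ∪
      (deletions μ ∩ deletions ν).image (fun v => p ++ (b :: (v ++ e :: w))))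

/-- The cores `a μ e` and `b ν f` differ at least twice, so both substitutions happen inside the
core and `y` agrees with both words elsewhere; in particular `π = π'`. -/
theorem mem_parallelWords_of_prefix {p μ ν w π π' y : List α} {a b e f : α} (hab : a ≠ b)
    (hef : e ≠ f) (hl : μ.length = ν.length) (hπ : π ∈ deletions p) (hπ' : π' ∈ deletions p)
    (h1 : y ∈ substitutions (π ++ (a :: (μ ++ e :: w))))
    (h2 : y ∈ substitutions (π' ++ (b :: (ν ++ f :: w)))) :
    y ∈ parallelWords p a μ e b ν f w := by
  have hπl := length_of_mem_deletions hπ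
  have hπl' := length_of_mem_deletions hπ'
  have hd := two_le_mismatches_core hab hef hl
  have r1 : a :: (μ ++ e :: w) = (a :: (μ ++ [e])) ++ w := by simp
  have r2 : b :: (ν ++ f :: w) = (b :: (ν ++ [f])) ++ w := by simp
  rw [r1, mem_substitutions] at h1
  rw [r2, mem_substitutions] at h2
  have hst : (a :: (μ ++ [e])).length = (b :: (ν ++ [f])).length := by simp [hl]
  rw [parallelWords, Finset.mem_union, Finset.mem_union]
  refine Or.inl (Or.inl ?_)
  generalize a :: (μ ++ [e]) = s at *
  generalize b :: (ν ++ [f]) = t at *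
  obtain ⟨hy, h1⟩ := h1
  obtain ⟨-, h2⟩ := h2
  rw [List.length_append] at hy
  obtain ⟨yp, y', rfl, hyp, hy'⟩ := exists_eq_append_of_length hy
  rw [List.length_append] at hy'
  obtain ⟨ym, yw, rfl, hym, hyw⟩ := exists_eq_append_of_length hy'
  rw [mismatches_append (by omega), mismatches_append (by omega)] at h1 h2
  have htri := mismatches_triangle (x := s) (y := ym) (z := t) (by omega) (by omega)
  rw [mismatches_comm ym t] at htri
  obtain rfl := (mismatches_eq_zero (x := π) (y := yp) (by omega)).1 (by omega)
  obtain rfl := (mismatches_eq_zero (x := w) (y := yw) (by omega)).1 (by omega)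
  refine Finset.mem_image.2 ⟨(π, ym), ?_, rfl⟩
  rw [Finset.mem_product, Finset.mem_inter, mem_substitutions, mem_substitutions]
  dsimp only
  exact ⟨hπ, ⟨by omega, by omega⟩, by omega, by omega⟩

theorem mem_parallelWords_of_suffix {p μ ν w ω ω' y : List α} {a b e f : α} (hab : a ≠ b)
    (hef : e ≠ f) (hl : μ.length = ν.length) (hω : ω ∈ deletions w) (hω' : ω' ∈ deletions w)
    (h1 : y ∈ substitutions (p ++ (a :: (μ ++ e :: ω))))
    (h2 : y ∈ substitutions (p ++ (b :: (ν ++ f :: ω')))) :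
    y ∈ parallelWords p a μ e b ν f w := by
  have hωl := length_of_mem_deletions hω
  have hωl' := length_of_mem_deletions hω'
  have hd := two_le_mismatches_core hab hef hl
  have r1 : a :: (μ ++ e :: ω) = (a :: (μ ++ [e])) ++ ω := by simp
  have r2 : b :: (ν ++ f :: ω') = (b :: (ν ++ [f])) ++ ω' := by simp
  rw [r1, mem_substitutions] at h1
  rw [r2, mem_substitutions] at h2
  have hst : (a :: (μ ++ [e])).length = (b :: (ν ++ [f])).length := by simp [hl]
  rw [parallelWords, Finset.mem_union, Finset.mem_union]
  refine Or.inl (Or.inr ?_)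
  generalize a :: (μ ++ [e]) = s at *
  generalize b :: (ν ++ [f]) = t at *
  obtain ⟨hy, h1⟩ := h1
  obtain ⟨-, h2⟩ := h2
  rw [List.length_append] at hy
  obtain ⟨yp, y', rfl, hyp, hy'⟩ := exists_eq_append_of_length hy
  rw [List.length_append] at hy'
  obtain ⟨ym, yw, rfl, hym, hyw⟩ := exists_eq_append_of_length hy'
  rw [mismatches_append (by omega), mismatches_append (by omega)] at h1 h2
  have htri := mismatches_triangle (x := s) (y := ym) (z := t) (by omega) (by omega)
  rw [mismatches_comm ym t] at htri
  obtain rfl := (mismatches_eq_zero (x := p) (y := yp) (by omega)).1 (by omega)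
  obtain rfl := (mismatches_eq_zero (x := ω) (y := yw) (by omega)).1 (by omega)
  refine Finset.mem_image.2 ⟨(ω, ym), ?_, rfl⟩
  rw [Finset.mem_product, Finset.mem_inter, mem_substitutions, mem_substitutions]
  dsimp only
  exact ⟨hω, ⟨by omega, by omega⟩, by omega, by omega⟩

/-- Each of the pairs `a`, `b` and `e`, `f` costs one substitution. Hence the middles agree, and
each word is exact at one of the two pairs, which leaves the ends `a`, `f` or `b`, `e`. -/
theorem mem_parallelWords_of_middle {p μ ν w v v' y : List α} {a b e f : α} (hab : a ≠ b)
    (hef : e ≠ f) (hl : μ.length = ν.length) (hv : v ∈ deletions μ) (hv' : v' ∈ deletions ν)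
    (h1 : y ∈ substitutions (p ++ (a :: (v ++ e :: w))))
    (h2 : y ∈ substitutions (p ++ (b :: (v' ++ f :: w)))) :
    y ∈ parallelWords p a μ e b ν f w := by
  have hvl := length_of_mem_deletions hv
  have hvl' := length_of_mem_deletions hv'
  rw [mem_substitutions] at h1 h2
  obtain ⟨hy, h1⟩ := h1
  obtain ⟨-, h2⟩ := h2
  rw [List.length_append] at hy
  obtain ⟨yp, y', rfl, hyp, hy'⟩ := exists_eq_append_of_length hy
  cases y' with
  | nil => simp at hy'
  | cons g y'' =>
  simp only [List.length_cons, Nat.add_right_cancel_iff, List.length_append] at hy'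
  obtain ⟨ym, y', rfl, hym, hyw⟩ := exists_eq_append_of_length hy'
  cases y' with
  | nil => simp at hyw
  | cons g' yw =>
  simp only [List.length_cons, Nat.add_right_cancel_iff] at hyw
  rw [mismatches_append (by omega), mismatches_cons, mismatches_append (by omega),
    mismatches_cons] at h1 h2
  have hg : a ≠ g ∨ b ≠ g := by
    by_contra! h
    exact hab (h.1.trans h.2.symm)
  have hg' : e ≠ g' ∨ f ≠ g' := by
    by_contra! h
    exact hef (h.1.trans h.2.symm)
  have hG : 1 ≤ (if a = g then 0 else 1) + (if b = g then 0 else 1) := by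
    rcases hg with h | h <;> simp [h]
  have hG' : 1 ≤ (if e = g' then 0 else 1) + (if f = g' then 0 else 1) := by
    rcases hg' with h | h <;> simp [h]
  obtain rfl := (mismatches_eq_zero (x := p) (y := yp) (by omega)).1 (by omega)
  obtain rfl := (mismatches_eq_zero (x := w) (y := yw) (by omega)).1 (by omega)
  obtain rfl := (mismatches_eq_zero (x := v) (y := ym) (by omega)).1 (by omega)
  obtain rfl := (mismatches_eq_zero (x := v') (y := v) (by omega)).1 (by omega)
  simp only [mismatches_self] at h1 h2
  simp only [parallelWords, Finset.mem_union, Finset.mem_image, Finset.mem_inter]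
  right
  by_cases ha : a = g
  · subst ha
    have hf : f = g' := by
      by_contra hf
      rw [if_neg hf, if_neg hab.symm] at h2
      omega
    subst hf
    exact Or.inl ⟨v', ⟨hv, hv'⟩, rfl⟩
  · have he : e = g' := by
      by_contra he
      rw [if_neg he, if_neg ha] at h1
      omega
    subst he
    have hb : b = g := by
      by_contra hb
      rw [if_neg hb, if_neg hef.symm] at h2
      omega
    subst hb
    exact Or.inr ⟨v', ⟨hv, hv'⟩, rfl⟩

theorem delSubWords_inter_subset {p μ ν w : List α} {a b e f : α} (hab : a ≠ b)
    (hef : e ≠ f) (hl : μ.length = ν.length) :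
    delSubWords (p ++ a :: (μ ++ e :: w)) ∩ delSubWords (p ++ b :: (ν ++ f :: w)) ⊆
      parallelWords p a μ e b ν f w ∪ crossWords p a μ e b ν f w ∪
        crossWords p b ν f a μ e w := by
  intro y hy
  rw [Finset.mem_inter, mem_delSubWords, mem_delSubWords] at hy
  obtain ⟨⟨u, hu, h1⟩, u', hu', h2⟩ := hy
  rw [Finset.mem_union, Finset.mem_union]
  simp only [crossWords]
  rw [Finset.mem_union (t := _ ∪ cornerWords p a μ e b ν f w), Finset.mem_union,
    Finset.mem_union (t := _ ∪ cornerWords p b ν f a μ e w),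
    Finset.mem_union (t := rightWords p b ν f a μ e w)]
  have hμ : ∀ {v : List α} {e : α}, v ∈ deletions μ → v ++ [e] ∈ deletions (μ ++ [e]) :=
    fun hv => mem_deletions_append.2 (Or.inl ⟨_, hv, rfl⟩)
  have hν : ∀ {v : List α} {e : α}, v ∈ deletions ν → v ++ [e] ∈ deletions (ν ++ [e]) :=
    fun hv => mem_deletions_append.2 (Or.inl ⟨_, hv, rfl⟩)
  have cμ : ∀ {v : List α} {e : α}, v ∈ deletions μ → e :: v ∈ deletions (e :: μ) :=
    fun hv => by simp [deletions, hv]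
  have cν : ∀ {v : List α} {e : α}, v ∈ deletions ν → e :: v ∈ deletions (e :: ν) :=
    fun hv => by simp [deletions, hv]
  rcases deletions_cases hu with ⟨π, hπ, rfl⟩ | ⟨v, hv, rfl⟩ | ⟨ω, hω, rfl⟩ <;>
    rcases deletions_cases hu' with ⟨π', hπ', rfl⟩ | ⟨v', hv', rfl⟩ | ⟨ω', hω', rfl⟩
  · have hπ₀ := hπ
    have hπ₀' := hπ'
    rw [mem_deletions_append] at hπ hπ'
    -- If the letter `a` or `b` itself is deleted, the deletion counts as one in the middle segment:
    -- `ν` is a deletion of `b ν`, and `μ` of `a μ`.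
    rcases hπ with ⟨π, hπ, rfl⟩ | ⟨t, ht, rfl⟩
    · rcases hπ' with ⟨π', hπ', rfl⟩ | ⟨t, ht, rfl⟩
      · exact Or.inl (Or.inl (mem_parallelWords_of_prefix hab hef hl hπ hπ' (by simpa using h1)
          (by simpa using h2)))
      · obtain rfl : t = [] := by simpa [deletions] using ht
        exact Or.inl (Or.inr (Or.inl (Or.inl (mem_leftWords hef hl hπ₀ (z := ν)
          (by simp [deletions]) h1 (by simpa using h2)))))
    · obtain rfl : t = [] := by simpa [deletions] using ht
      exact Or.inr (Or.inl (Or.inl (mem_leftWords hef.symm hl.symm hπ₀' (z := μ)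
        (by simp [deletions]) h2 (by simpa using h1))))
  · exact Or.inl (Or.inr (Or.inl (Or.inl (mem_leftWords hef hl hπ (cν hv') h1 (by simpa using h2)))))
  · exact Or.inl (Or.inr (Or.inr (mem_cornerWords hl hπ hω' h1 h2)))
  · exact Or.inr (Or.inl (Or.inl (mem_leftWords hef.symm hl.symm hπ' (cμ hv) h2 (by simpa using h1))))
  · exact Or.inl (Or.inl (mem_parallelWords_of_middle hab hef hl hv hv' h1 h2))
  · exact Or.inl (Or.inr (Or.inl (Or.inr (mem_rightWords hab hl hω' (hμ hv) (by simpa using h1) h2))))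
  · exact Or.inr (Or.inr (mem_cornerWords hl.symm hπ' hω h2 h1))
  · exact Or.inr (Or.inl (Or.inr (mem_rightWords hab.symm hl.symm hω (hν hv') (by simpa using h2) h1)))
  · have hω₀ := hω
    have hω₀' := hω'
    simp only [deletions, Finset.mem_insert, Finset.mem_image] at hω hω'
    rcases hω with rfl | ⟨ω, hω, rfl⟩
    · exact Or.inl (Or.inr (Or.inl (Or.inr (mem_rightWords hab hl hω₀' (z := μ)
        (mem_deletions_append.2 (Or.inr ⟨[], by simp [deletions]⟩)) h1 h2))))
    · rcases hω' with rfl | ⟨ω', hω', rfl⟩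
      · exact Or.inr (Or.inl (Or.inr (mem_rightWords hab.symm hl.symm hω₀ (z := ν)
          (mem_deletions_append.2 (Or.inr ⟨[], by simp [deletions]⟩)) h2 h1)))
      · exact Or.inl (Or.inl (mem_parallelWords_of_suffix hab hef hl hω hω' h1 h2))

end Cover

/-! ### Sizes of the covering sets and the upper bound -/

section Bounds

variable {α : Type*} [DecidableEq α]

theorem exists_first_difference {x x' : List α} (hl : x.length = x'.length) (h : x ≠ x') :
    ∃ p a u b v, a ≠ b ∧ u.length = v.length ∧ x = p ++ a :: u ∧ x' = p ++ b :: v := by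
  induction x generalizing x' with
  | nil => cases x' <;> simp_all
  | cons c x ih =>
    cases x' with
    | nil => simp at hl
    | cons d x' =>
      by_cases hcd : c = d
      · subst hcd
        obtain ⟨p, a, u, b, v, hab, huv, rfl, rfl⟩ := ih (by simpa using hl) (by simpa using h)
        exact ⟨c :: p, a, u, b, v, hab, huv, rfl, rfl⟩
      · exact ⟨[], c, x, d, x', hcd, by simpa using hl, rfl, rfl⟩

theorem exists_last_difference {x x' : List α} (hl : x.length = x'.length) (h : x ≠ x') :
    ∃ μ e ν f w, e ≠ f ∧ μ.length = ν.length ∧ x = μ ++ e :: w ∧ x' = ν ++ f :: w := by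
  obtain ⟨p, a, u, b, v, hab, huv, h1, h2⟩ :=
    exists_first_difference (x := x.reverse) (x' := x'.reverse) (by simpa) (by simpa)
  exact ⟨u.reverse, a, v.reverse, b, p.reverse, hab, by simpa,
    by simpa using congrArg List.reverse h1, by simpa using congrArg List.reverse h2⟩

/-- A second mismatch guarantees that the last difference is not the first one. -/
theorem exists_core {x x' : List α} (hl : x.length = x'.length) (h : 2 ≤ mismatches x x') :
    ∃ p a μ e w b ν f, a ≠ b ∧ e ≠ f ∧ μ.length = ν.length ∧ x = p ++ a :: (μ ++ e :: w) ∧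
      x' = p ++ b :: (ν ++ f :: w) := by
  have hne : x ≠ x' := by
    rintro rfl
    simp at h
  obtain ⟨p, a, u, b, v, hab, huv, rfl, rfl⟩ := exists_first_difference hl hne
  have huv' : u ≠ v := by
    rintro rfl
    simp [mismatches_append, hab] at h
  obtain ⟨μ, e, ν, f, w, hef, hμν, rfl, rfl⟩ := exists_last_difference huv huv'
  exact ⟨p, a, μ, e, w, b, ν, f, hab, hef, hμν, rfl, rfl⟩

@[simp] theorem prefixShifts_nil (a : α) : prefixShifts [] a = ∅ := by
  simp [prefixShifts]

@[simp] theorem suffixShifts_nil (a : α) : suffixShifts a [] = ∅ := by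
  simp [suffixShifts]

theorem append_mem_prefixShifts {p π : List α} {a : α} (h : π ∈ prefixShifts p a) :
    ∃ v ∈ deletions p, π = v ++ [a] := by
  rw [mem_prefixShifts, mem_deletions_append] at h
  obtain ⟨h | ⟨v, hv, rfl⟩, hm⟩ := h
  · exact h
  · obtain rfl : v = [] := by simpa [deletions] using hv
    simp at hm

theorem cons_mem_suffixShifts {w ω : List α} {f : α} (h : ω ∈ suffixShifts f w) :
    ∃ v ∈ deletions w, ω = f :: v := by
  rw [mem_suffixShifts, deletions, Finset.mem_insert, Finset.mem_image] at h
  obtain ⟨rfl | ⟨v, hv, rfl⟩, hm⟩ := h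
  · simp at hm
  · exact ⟨v, hv, rfl⟩

/-- The words of `crossWords` outside the substitution ball of the common deletion, when there
is one. -/
def crossExtras (p : List α) (a : α) (μ : List α) (b : α) (ν : List α) (f : α) (w : List α) :
    Finset (List α) :=
  (prefixShifts p a).image (fun π => π ++ (μ ++ f :: w)) ∪
    (suffixShifts f w).image (fun ω => p ++ (a :: (ν ++ ω))) ∪
    ((prefixShifts p a) ×ˢ (suffixShifts f w)).image (fun t => t.1 ++ (b :: (ν ++ t.2)))

theorem card_corner_image_le_one (p w : List α) (a f : α) (F : List α × List α → List α) :
    (((prefixShifts p a) ×ˢ (suffixShifts f w)).image F).card ≤ 1 := by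
  refine Finset.card_image_le.trans ?_
  rw [Finset.card_product]
  exact Nat.mul_le_mul (card_prefixShifts_le_one p a) (card_suffixShifts_le_one f w)

theorem card_crossExtras_le (p : List α) (a : α) (μ : List α) (b : α) (ν : List α) (f : α)
    (w : List α) : (crossExtras p a μ b ν f w).card ≤ 3 := by
  have h1 := (Finset.card_image_le (s := prefixShifts p a)
    (f := fun π => π ++ (μ ++ f :: w))).trans (card_prefixShifts_le_one p a)
  have h2 := (Finset.card_image_le (s := suffixShifts f w)
    (f := fun ω => p ++ (a :: (ν ++ ω)))).trans (card_suffixShifts_le_one f w)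
  have h3 := card_corner_image_le_one p w a f (fun t => t.1 ++ (b :: (ν ++ t.2)))
  refine (Finset.card_union_le _ _).trans ?_
  refine (Nat.add_le_add_right (Finset.card_union_le _ _) _).trans ?_
  omega

/-- Each pair in `K` is lost from the count `2 * D.card`, because its word is already in `V`. -/
theorem card_image_product_pair_sdiff_le {β : Type*} [DecidableEq β] {D : Finset β} {a b : α}
    {F : β × α → List α} {V : Finset (List α)} {K : Finset (β × α)} (hK : K ⊆ D ×ˢ {a, b})
    (hKV : ∀ k ∈ K, F k ∈ V) :
    ((D ×ˢ {a, b}).image F \ V).card + K.card ≤ 2 * D.card := by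
  have hsub : (D ×ˢ {a, b}).image F \ V ⊆ ((D ×ˢ {a, b}) \ K).image F := by
    intro y hy
    obtain ⟨hy, hyV⟩ := Finset.mem_sdiff.1 hy
    obtain ⟨t, ht, rfl⟩ := Finset.mem_image.1 hy
    exact Finset.mem_image_of_mem F (Finset.mem_sdiff.2 ⟨ht, fun hk => hyV (hKV t hk)⟩)
  have h1 := (Finset.card_le_card hsub).trans Finset.card_image_le
  have h2 := Finset.card_sdiff_add_card_eq_card hK
  have h3 : (D ×ˢ ({a, b} : Finset α)).card ≤ D.card * 2 := by
    rw [Finset.card_product]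
    exact Nat.mul_le_mul_left _ Finset.card_le_two
  omega

theorem card_pair {a b : α} {β : Type*} [DecidableEq β] (hab : a ≠ b) (u : β) :
    ({(u, a), (u, b)} : Finset (β × α)).card = 2 :=
  Finset.card_pair (by simp [hab])

theorem card_insert_pair {a b c : α} {β : Type*} [DecidableEq β] (hab : a ≠ b) {u v : β}
    (huv : v ≠ u) : ({(v, c), (u, a), (u, b)} : Finset (β × α)).card = 3 := by
  rw [Finset.card_insert_of_notMem (by simp [huv]), card_pair hab]

/-- The exceptional words reached from `p a b w` and `p b a w` by one deletion in `p` and one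
in `w`. -/
def swapCornerWords (p : List α) (a b : α) (w : List α) : Finset (List α) :=
  ((prefixShifts p a) ×ˢ (suffixShifts a w)).image (fun t => t.1 ++ b :: t.2) ∪
    ((prefixShifts p b) ×ˢ (suffixShifts b w)).image (fun t => t.1 ++ a :: t.2)

/-- For an adjacent swap two of the three possible extra words are already counted: a shifted `π`
ends in `a` and a shifted `ω` begins with `a`, so they have the doubled-letter form of the parallel
words. -/
theorem crossExtras_nil_subset (p w : List α) (a b : α) :
    crossExtras p a [] b [] a w ⊆ ((deletions p).image (fun v => v ++ a :: a :: w) ∪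
      (deletions w).image (fun v => p ++ a :: a :: v)) ∪
      ((prefixShifts p a) ×ˢ (suffixShifts a w)).image (fun t => t.1 ++ b :: t.2) := by
  intro y hy
  simp only [crossExtras, Finset.mem_union] at hy ⊢
  rcases hy with (hy | hy) | hy
  · obtain ⟨π, hπ, rfl⟩ := Finset.mem_image.1 hy
    obtain ⟨v, hv, rfl⟩ := append_mem_prefixShifts hπ
    exact Or.inl (Or.inl (Finset.mem_image.2 ⟨v, hv, by simp⟩))
  · obtain ⟨ω, hω, rfl⟩ := Finset.mem_image.1 hy
    obtain ⟨v, hv, rfl⟩ := cons_mem_suffixShifts hω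
    exact Or.inl (Or.inr (Finset.mem_image.2 ⟨v, hv, by simp⟩))
  · exact Or.inr hy

theorem card_swapCornerWords_le (p w : List α) (a b : α) : (swapCornerWords p a b w).card ≤ 2 :=
  (Finset.card_union_le _ _).trans
    (Nat.add_le_add (card_corner_image_le_one ..) (card_corner_image_le_one ..))

variable [Fintype α]

theorem card_leftWords_le (p : List α) (a : α) {μ : List α} (e b : α) {ν : List α} (f : α)
    (w : List α) (hl : μ.length = ν.length) :
    (leftWords p a μ e b ν f w).card ≤ 3 + Fintype.card α + 1 := by
  refine (Finset.card_union_le _ _).trans (Nat.add_le_add ((Finset.card_union_le _ _).trans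
    (Nat.add_le_add ?_ ?_)) ?_)
  · exact Finset.card_image_le.trans (card_deletions_filter_near_le_three _ (by simpa))
  · exact Finset.card_image_le.trans (by simp)
  · exact Finset.card_image_le.trans (card_prefixShifts_le_one p a)

theorem card_rightWords_le (p : List α) (a : α) {μ : List α} (e b : α) {ν : List α} (f : α)
    (w : List α) (hl : μ.length = ν.length) :
    (rightWords p a μ e b ν f w).card ≤ 3 + Fintype.card α + 1 := by
  refine (Finset.card_union_le _ _).trans (Nat.add_le_add ((Finset.card_union_le _ _).trans
    (Nat.add_le_add ?_ ?_)) ?_)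
  · exact Finset.card_image_le.trans (card_deletions_filter_near_le_three _ (by simp [hl]))
  · exact Finset.card_image_le.trans (by simp)
  · exact Finset.card_image_le.trans (card_suffixShifts_le_one f w)

/-- The left and right words number at most `q + 4` each, the two distinct balls share at most `q`
words, and two corner words may be added. -/
theorem card_crossWords_le (hq : 2 ≤ Fintype.card α) (p : List α) (a : α) {μ : List α} {e b : α}
    {ν : List α} (f : α) (w : List α) (hl : μ.length = ν.length) (h : μ ++ [e] ≠ b :: ν) :
    (crossWords p a μ e b ν f w).card ≤ 3 * Fintype.card α + 10 := by
  have h1 := card_leftWords_le p a e b f w hl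
  have h2 := card_rightWords_le p a e b f w hl
  have h3 : (substitutions (p ++ (μ ++ e :: w)) ∩ substitutions (p ++ (b :: (ν ++ w)))).card ≤
      Fintype.card α := by
    refine card_substitutions_inter_le hq (by simp; omega) ?_
    intro heq
    apply h
    have r1 : p ++ (μ ++ e :: w) = p ++ ((μ ++ [e]) ++ w) := by simp
    have r2 : p ++ (b :: (ν ++ w)) = p ++ ((b :: ν) ++ w) := by simp
    rw [r1, r2] at heq
    exact List.append_cancel_right (List.append_cancel_left heq)
  have h4 : (cornerWords p a μ e b ν f w).card ≤ 2 := by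
    rw [cornerWords, if_neg h]
    refine (Finset.card_union_le _ _).trans ?_
    have h1 := (Finset.card_image_le (s := prefixShifts p a)
      (f := fun π => π ++ (b :: (ν ++ w)))).trans (card_prefixShifts_le_one p a)
    have h2 := (Finset.card_image_le (s := suffixShifts f w)
      (f := fun ω => p ++ (μ ++ e :: ω))).trans (card_suffixShifts_le_one f w)
    omega
  have h5 := Finset.card_union_le (leftWords p a μ e b ν f w ∪ rightWords p a μ e b ν f w)
    ((substitutions (p ++ (μ ++ e :: w)) ∩ substitutions (p ++ (b :: (ν ++ w)))) ∪
      cornerWords p a μ e b ν f w)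
  have h6 := Finset.card_union_le (leftWords p a μ e b ν f w) (rightWords p a μ e b ν f w)
  have h7 := Finset.card_union_le
    (substitutions (p ++ (μ ++ e :: w)) ∩ substitutions (p ++ (b :: (ν ++ w))))
    (cornerWords p a μ e b ν f w)
  rw [crossWords]
  omega

theorem append_mem_substitutions {p u v w : List α} (hl : u.length = v.length)
    (h : mismatches u v ≤ 1) : p ++ (v ++ w) ∈ substitutions (p ++ (u ++ w)) := by
  rw [mem_substitutions, mismatches_append rfl, mismatches_append hl]
  simpa [hl] using h

/-- Since `p μ e w` and `p b ν w` coincide, left and right words without a shift are one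
substitution away from this common deletion. Only the words involving a shift of `p` or `w` can
leave its ball. -/
theorem crossWords_subset {p : List α} {a : α} {μ : List α} {e b : α} {ν : List α} {f : α}
    {w : List α} (hl : μ.length = ν.length) (h : μ ++ [e] = b :: ν) :
    crossWords p a μ e b ν f w ⊆
      substitutions (p ++ (b :: (ν ++ w))) ∪ crossExtras p a μ b ν f w := by
  have r1 : p ++ (b :: (ν ++ w)) = p ++ ((μ ++ [e]) ++ w) := by rw [h]; simp
  have r2 : p ++ (b :: (ν ++ w)) = p ++ ((b :: ν) ++ w) := by simp
  intro y hy
  simp only [crossWords, cornerWords, if_pos h, leftWords, rightWords] at hy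
  simp only [crossExtras, Finset.mem_union, or_assoc] at hy ⊢
  rcases hy with hy | hy | hy | hy | hy | hy | hy | hy
  · left
    obtain ⟨z, hz, rfl⟩ := Finset.mem_image.1 hy
    obtain ⟨hz, hm⟩ := Finset.mem_filter.1 hz
    have hzl := length_of_mem_deletions hz
    simp only [List.length_cons] at hzl
    have : p ++ (z ++ e :: w) = p ++ ((z ++ [e]) ++ w) := by simp
    rw [r1, this]
    exact append_mem_substitutions (by simp; omega) (by
      rw [mismatches_append (by omega)]
      simpa)
  · left
    obtain ⟨g, -, rfl⟩ := Finset.mem_image.1 hy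
    have : p ++ (μ ++ g :: w) = p ++ ((μ ++ [g]) ++ w) := by simp
    rw [r1, this]
    exact append_mem_substitutions (by simp) (by
      rw [mismatches_append rfl]
      simp
      split_ifs <;> simp)
  · exact Or.inr (Or.inl hy)
  · left
    obtain ⟨z, hz, rfl⟩ := Finset.mem_image.1 hy
    obtain ⟨hz, hm⟩ := Finset.mem_filter.1 hz
    have hzl := length_of_mem_deletions hz
    simp only [List.length_append, List.length_cons, List.length_nil] at hzl
    have : p ++ (b :: (z ++ w)) = p ++ ((b :: z) ++ w) := by simp
    rw [r2, this]
    exact append_mem_substitutions (by simp; omega) (by simpa)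
  · left
    obtain ⟨g, -, rfl⟩ := Finset.mem_image.1 hy
    have : p ++ (g :: (ν ++ w)) = p ++ ((g :: ν) ++ w) := by simp
    rw [r2, this]
    exact append_mem_substitutions (by simp) (by
      simp
      split_ifs <;> simp)
  · exact Or.inr (Or.inr (Or.inl hy))
  · exact Or.inl (Finset.mem_inter.1 hy).2
  · exact Or.inr (Or.inr (Or.inr hy))

theorem card_crossWords_le_of_eq {p : List α} {a : α} {μ : List α} {e b : α} {ν : List α} {f : α}
    {w : List α} (hl : μ.length = ν.length) (h : μ ++ [e] = b :: ν) :
    (crossWords p a μ e b ν f w).card ≤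
      1 + (p.length + (ν.length + w.length + 1)) * (Fintype.card α - 1) + 3 := by
  refine (Finset.card_le_card (crossWords_subset hl h)).trans ((Finset.card_union_le _ _).trans
    (Nat.add_le_add (le_of_eq ?_) (card_crossExtras_le ..)))
  rw [card_substitutions]
  simp

theorem card_parallelWords_le (p : List α) {a : α} {μ : List α} {e b : α} {ν : List α} {f : α}
    (w : List α) (hab : a ≠ b) (hef : e ≠ f) (hl : μ.length = ν.length) :
    (parallelWords p a μ e b ν f w).card ≤ 2 * (p.length + μ.length + w.length) := by
  have hS := card_substitutions_inter_le_two (by simp [hl]) (two_le_mismatches_core hab hef hl)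
  have h1 := Nat.mul_le_mul (card_deletions_le p) hS
  have h2 := Nat.mul_le_mul (card_deletions_le w) hS
  have h3 := (Finset.card_le_card (Finset.inter_subset_left
    (s₁ := deletions μ) (s₂ := deletions ν))).trans (card_deletions_le μ)
  rw [← Finset.card_product] at h1 h2
  rw [parallelWords]
  refine (Finset.card_union_le _ _).trans ((Nat.add_le_add ((Finset.card_union_le _ _).trans
    (Nat.add_le_add (Finset.card_image_le.trans h1) (Finset.card_image_le.trans h2)))
    ((Finset.card_union_le _ _).trans (Nat.add_le_add (Finset.card_image_le.trans h3)
    (Finset.card_image_le.trans h3)))).trans ?_)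
  omega

/-- With `μ ≠ ν` the cores have distance at least three, so deletions in `p` or `w` contribute
nothing, and `μ`, `ν` share at most two deletions. -/
theorem card_parallelWords_le_four (p : List α) {a : α} {μ : List α} {e b : α} {ν : List α} {f : α}
    (w : List α) (hab : a ≠ b) (hef : e ≠ f) (hl : μ.length = ν.length) (hne : μ ≠ ν) :
    (parallelWords p a μ e b ν f w).card ≤ 4 := by
  have hS : substitutions (a :: (μ ++ [e])) ∩ substitutions (b :: (ν ++ [f])) = ∅ := by
    apply substitutions_inter_eq_empty
    have := mt (mismatches_eq_zero hl).1 hne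
    simp [mismatches_append hl, hab, hef]
    omega
  have h3 := card_deletions_inter_le_two hne
  rw [parallelWords, hS]
  simp only [Finset.product_empty, Finset.image_empty, Finset.empty_union]
  exact (Finset.card_union_le _ _).trans (Nat.add_le_add (Finset.card_image_le.trans h3)
    (Finset.card_image_le.trans h3))

/-- The union of the substitution balls of the two common deletions of `p a b w` and `p b a w`. -/
def swapBalls (p : List α) (a b : α) (w : List α) : Finset (List α) :=
  substitutions (p ++ b :: w) ∪ substitutions (p ++ a :: w)

/-- The words `v g g w` with `v` a deletion of `p` and `g` one of `a`, `b`. -/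
def swapPrefixWords (p : List α) (a b : α) (w : List α) : Finset (List α) :=
  (deletions p ×ˢ {a, b}).image (fun t => t.1 ++ t.2 :: t.2 :: w)

/-- The words `p g g v` with `v` a deletion of `w` and `g` one of `a`, `b`. -/
def swapSuffixWords (p : List α) (a b : α) (w : List α) : Finset (List α) :=
  (deletions w ×ˢ {a, b}).image (fun t => p ++ t.2 :: t.2 :: t.1)

theorem mem_swapBalls_of_mismatches {p w y : List α} {a b g : α} (hg : g = a ∨ g = b)
    (hl : (p ++ g :: w).length = y.length) (h : mismatches (p ++ g :: w) y ≤ 1) :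
    y ∈ swapBalls p a b w := by
  rw [swapBalls, Finset.mem_union, mem_substitutions, mem_substitutions]
  rcases hg with rfl | rfl
  · exact Or.inr ⟨hl, h⟩
  · exact Or.inl ⟨hl, h⟩

theorem card_swapBalls_le (p w : List α) (a b : α) :
    (swapBalls p a b w).card + Fintype.card α ≤
      2 * (1 + (p.length + w.length + 1) * (Fintype.card α - 1)) := by
  have h := Finset.card_union_add_card_inter (substitutions (p ++ b :: w))
    (substitutions (p ++ a :: w))
  rw [card_substitutions, card_substitutions] at h
  have h2 : Fintype.card α ≤ (substitutions (p ++ b :: w) ∩ substitutions (p ++ a :: w)).card := by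
    have hinj : Function.Injective (fun g : α => p ++ g :: w) := by
      intro g g' h
      simpa using h
    rw [← Finset.card_univ, ← Finset.card_image_of_injective Finset.univ hinj]
    refine Finset.card_le_card fun y hy => ?_
    obtain ⟨g, -, rfl⟩ := Finset.mem_image.1 hy
    simp only [Finset.mem_inter, mem_substitutions, mismatches_append, mismatches_self,
      mismatches_cons, List.length_append, List.length_cons, true_and]
    constructor <;> split_ifs <;> simp
  rw [swapBalls]
  simp only [List.length_append, List.length_cons, ← add_assoc] at h
  omega

/-- Writing `p = p₀ c`, the words `p₀ g g w` for the two letters `g` are one substitution away from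
`p₀ c g w`, so two of the `2 * p.length` candidates are lost to the balls. -/
theorem card_swapPrefixWords_sdiff_le {p w : List α} {a b : α} (hab : a ≠ b) (hp : p ≠ []) :
    (swapPrefixWords p a b w \ swapBalls p a b w).card + 2 ≤ 2 * p.length := by
  obtain ⟨p₀, c, rfl⟩ : ∃ p₀ c, p = p₀ ++ [c] := ⟨_, _, (List.dropLast_append_getLast hp).symm⟩
  have hmem : p₀ ∈ deletions (p₀ ++ [c]) := mem_deletions.2 ⟨p₀, c, [], by simp, by simp⟩
  have := card_image_product_pair_sdiff_le (a := a) (b := b) (D := deletions (p₀ ++ [c]))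
    (F := fun t => t.1 ++ t.2 :: t.2 :: w) (V := swapBalls (p₀ ++ [c]) a b w)
    (K := {(p₀, a), (p₀, b)}) ?_ ?_
  · rw [card_pair hab] at this
    have h2 := card_deletions_le (p₀ ++ [c])
    rw [swapPrefixWords]
    omega
  · simp [Finset.insert_subset_iff, hmem]
  · have key : ∀ g, g = a ∨ g = b → p₀ ++ g :: g :: w ∈ swapBalls (p₀ ++ [c]) a b w := by
      intro g hg
      refine mem_swapBalls_of_mismatches hg (by simp) ?_
      simp [mismatches_append]
      split_ifs <;> simp
    intro k hk
    simp only [Finset.mem_insert, Finset.mem_singleton] at hk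
    rcases hk with rfl | rfl
    · exact key a (Or.inl rfl)
    · exact key b (Or.inr rfl)

theorem card_swapSuffixWords_sdiff_le {p w : List α} {a b : α} (hab : a ≠ b) (hw : w ≠ []) :
    (swapSuffixWords p a b w \ swapBalls p a b w).card + 2 ≤ 2 * w.length := by
  obtain ⟨c, w₀, rfl⟩ := List.exists_cons_of_ne_nil hw
  have hmem : w₀ ∈ deletions (c :: w₀) := by simp [deletions]
  have := card_image_product_pair_sdiff_le (a := a) (b := b) (D := deletions (c :: w₀))
    (F := fun t => p ++ t.2 :: t.2 :: t.1) (V := swapBalls p a b (c :: w₀))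
    (K := {(w₀, a), (w₀, b)}) ?_ ?_
  · rw [card_pair hab] at this
    have h2 := card_deletions_le (c :: w₀)
    rw [swapSuffixWords]
    omega
  · simp [Finset.insert_subset_iff, hmem]
  · have key : ∀ g, g = a ∨ g = b → p ++ g :: g :: w₀ ∈ swapBalls p a b (c :: w₀) := by
      intro g hg
      refine mem_swapBalls_of_mismatches hg (by simp) ?_
      simp [mismatches_append]
      split_ifs <;> simp
    intro k hk
    simp only [Finset.mem_insert, Finset.mem_singleton] at hk
    rcases hk with rfl | rfl
    · exact key a (Or.inl rfl)
    · exact key b (Or.inr rfl)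

theorem eq_or_eq_of_card_eq_two (hq : Fintype.card α = 2) {a b : α} (hab : a ≠ b) (c : α) :
    c = a ∨ c = b := by
  have h : ({a, b} : Finset α) = Finset.univ :=
    Finset.eq_univ_of_card _ (by rw [Finset.card_pair hab, hq])
  simpa [← h] using Finset.mem_univ c

/-- In a binary alphabet one more word is lost. If the last two letters of `p` agree, `p` has fewer
deletions. If they are `d ≠ c`, then `c` is `a` or `b`, and `p₀ c c c w` is one substitution away
from `p₀ d c c w`. -/
theorem card_swapPrefixWords_sdiff_le_of_card_eq_two (hq : Fintype.card α = 2) {p w : List α}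
    {a b : α} (hab : a ≠ b) (hp : 2 ≤ p.length) :
    (swapPrefixWords p a b w \ swapBalls p a b w).card + 3 ≤ 2 * p.length := by
  obtain ⟨p₁, c, rfl⟩ : ∃ p₁ c, p = p₁ ++ [c] :=
    ⟨_, _, (List.dropLast_append_getLast (by rintro rfl; simp at hp)).symm⟩
  obtain ⟨p₀, d, rfl⟩ : ∃ p₀ d, p₁ = p₀ ++ [d] :=
    ⟨_, _, (List.dropLast_append_getLast (by rintro rfl; simp at hp)).symm⟩
  have hc := eq_or_eq_of_card_eq_two hq hab c
  have hmem : p₀ ++ [d] ∈ deletions (p₀ ++ [d] ++ [c]) :=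
    mem_deletions.2 ⟨p₀ ++ [d], c, [], by simp, by simp⟩
  have hmem' : p₀ ++ [c] ∈ deletions (p₀ ++ [d] ++ [c]) :=
    mem_deletions.2 ⟨p₀, d, [c], by simp, by simp⟩
  have key : ∀ g, g = a ∨ g = b →
      p₀ ++ [d] ++ g :: g :: w ∈ swapBalls (p₀ ++ [d] ++ [c]) a b w := by
    intro g hg
    refine mem_swapBalls_of_mismatches hg (by simp) ?_
    simp [mismatches_append]
    split_ifs <;> simp
  rw [swapPrefixWords]
  by_cases hdc : d = c
  · subst hdc
    have := card_image_product_pair_sdiff_le (a := a) (b := b) (D := deletions (p₀ ++ [d] ++ [d]))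
      (F := fun t => t.1 ++ t.2 :: t.2 :: w) (V := swapBalls (p₀ ++ [d] ++ [d]) a b w)
      (K := {(p₀ ++ [d], a), (p₀ ++ [d], b)}) ?_ ?_
    · rw [card_pair hab] at this
      have h2 : (deletions (p₀ ++ [d] ++ [d])).card ≤ (p₀ ++ [d]).length := by
        refine (Finset.card_le_card (t := (deletions (p₀ ++ [d])).image (· ++ [d])) ?_).trans
          (Finset.card_image_le.trans (card_deletions_le _))
        intro v hv
        rw [Finset.mem_image]
        rcases mem_deletions_append.1 hv with ⟨v, hv', rfl⟩ | ⟨v, hv', rfl⟩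
        · exact ⟨v, hv', rfl⟩
        · obtain rfl : v = [] := by simpa [deletions] using hv'
          exact ⟨p₀, mem_deletions.2 ⟨p₀, d, [], by simp, by simp⟩, by simp⟩
      simp only [List.length_append, List.length_cons, List.length_nil] at h2 ⊢
      omega
    · simpa [Finset.insert_subset_iff] using hmem
    · intro k hk
      simp only [Finset.mem_insert, Finset.mem_singleton] at hk
      rcases hk with rfl | rfl
      · exact key a (Or.inl rfl)
      · exact key b (Or.inr rfl)
  · have := card_image_product_pair_sdiff_le (a := a) (b := b) (D := deletions (p₀ ++ [d] ++ [c]))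
      (F := fun t => t.1 ++ t.2 :: t.2 :: w) (V := swapBalls (p₀ ++ [d] ++ [c]) a b w)
      (K := {(p₀ ++ [c], c), (p₀ ++ [d], a), (p₀ ++ [d], b)}) ?_ ?_
    · rw [card_insert_pair hab (by simpa using Ne.symm hdc)] at this
      have h2 := card_deletions_le (p₀ ++ [d] ++ [c])
      omega
    · simp only [Finset.insert_subset_iff, Finset.singleton_subset_iff, Finset.mem_product,
        Finset.mem_insert, Finset.mem_singleton, hmem, hmem', hc]
      simp
    · intro k hk
      simp only [Finset.mem_insert, Finset.mem_singleton] at hk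
      rcases hk with rfl | rfl | rfl
      · refine mem_swapBalls_of_mismatches hc (by simp) ?_
        simp [mismatches_append, hdc]
      · exact key a (Or.inl rfl)
      · exact key b (Or.inr rfl)

theorem card_swapSuffixWords_sdiff_le_of_card_eq_two (hq : Fintype.card α = 2) {p w : List α}
    {a b : α} (hab : a ≠ b) (hw : 2 ≤ w.length) :
    (swapSuffixWords p a b w \ swapBalls p a b w).card + 3 ≤ 2 * w.length := by
  obtain ⟨c, w₁, rfl⟩ := List.exists_cons_of_ne_nil (l := w) (by rintro rfl; simp at hw)
  obtain ⟨d, w₀, rfl⟩ := List.exists_cons_of_ne_nil (l := w₁) (by rintro rfl; simp at hw)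
  have hc := eq_or_eq_of_card_eq_two hq hab c
  have hmem : d :: w₀ ∈ deletions (c :: d :: w₀) := by simp [deletions]
  have hmem' : c :: w₀ ∈ deletions (c :: d :: w₀) := by simp [deletions]
  have key : ∀ g, g = a ∨ g = b →
      p ++ g :: g :: d :: w₀ ∈ swapBalls p a b (c :: d :: w₀) := by
    intro g hg
    refine mem_swapBalls_of_mismatches hg (by simp) ?_
    simp [mismatches_append]
    split_ifs <;> simp
  rw [swapSuffixWords]
  by_cases hdc : d = c
  · subst hdc
    have := card_image_product_pair_sdiff_le (a := a) (b := b) (D := deletions (d :: d :: w₀))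
      (F := fun t => p ++ t.2 :: t.2 :: t.1) (V := swapBalls p a b (d :: d :: w₀))
      (K := {(d :: w₀, a), (d :: w₀, b)}) ?_ ?_
    · rw [card_pair hab] at this
      have h2 : (deletions (d :: d :: w₀)).card ≤ (d :: w₀).length := by
        refine (Finset.card_le_card (t := (deletions (d :: w₀)).image (List.cons d)) ?_).trans
          (Finset.card_image_le.trans (card_deletions_le _))
        intro v hv
        rw [deletions, Finset.mem_insert] at hv
        rcases hv with rfl | hv
        · exact Finset.mem_image_of_mem _ (by simp [deletions])
        · exact hv
      simp only [List.length_cons] at h2 ⊢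
      omega
    · simp [Finset.insert_subset_iff, hmem]
    · intro k hk
      simp only [Finset.mem_insert, Finset.mem_singleton] at hk
      rcases hk with rfl | rfl
      · exact key a (Or.inl rfl)
      · exact key b (Or.inr rfl)
  · have := card_image_product_pair_sdiff_le (a := a) (b := b) (D := deletions (c :: d :: w₀))
      (F := fun t => p ++ t.2 :: t.2 :: t.1) (V := swapBalls p a b (c :: d :: w₀))
      (K := {(c :: w₀, c), (d :: w₀, a), (d :: w₀, b)}) ?_ ?_
    · rw [card_insert_pair hab (by simpa using Ne.symm hdc)] at this
      have h2 := card_deletions_le (c :: d :: w₀)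
      omega
    · simp only [Finset.insert_subset_iff, Finset.singleton_subset_iff, Finset.mem_product,
        Finset.mem_insert, Finset.mem_singleton, hmem, hmem', hc]
      simp
    · intro k hk
      simp only [Finset.mem_insert, Finset.mem_singleton] at hk
      rcases hk with rfl | rfl | rfl
      · refine mem_swapBalls_of_mismatches hc (by simp) ?_
        simp [mismatches_append, hdc]
      · exact key a (Or.inl rfl)
      · exact key b (Or.inr rfl)

/-- The general cover with `μ` and `ν` empty, regrouped so that words already in the two balls are
not counted again. -/
theorem delSubWords_swap_inter_subset {p w : List α} {a b : α} (hab : a ≠ b) :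
    delSubWords (p ++ a :: b :: w) ∩ delSubWords (p ++ b :: a :: w) ⊆
      swapBalls p a b w ∪ (swapPrefixWords p a b w \ swapBalls p a b w) ∪
        (swapSuffixWords p a b w \ swapBalls p a b w) ∪ swapCornerWords p a b w := by
  intro y hy
  have h := delSubWords_inter_subset (p := p) (μ := []) (ν := []) (w := w) hab hab.symm rfl
    (by simpa using hy)
  have hP : ∀ g, g = a ∨ g = b → ∀ v ∈ deletions p,
      v ++ g :: g :: w ∈ swapPrefixWords p a b w := fun g hg v hv =>
    Finset.mem_image.2 ⟨(v, g), by simp [hv, hg], rfl⟩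
  have hS : ∀ g, g = a ∨ g = b → ∀ v ∈ deletions w,
      p ++ g :: g :: v ∈ swapSuffixWords p a b w := fun g hg v hv =>
    Finset.mem_image.2 ⟨(v, g), by simp [hv, hg], rfl⟩
  have hcore : ∀ z ∈ substitutions [a, b] ∩ substitutions [b, a], z = [a, a] ∨ z = [b, b] := by
    intro z hz
    rcases mem_substitutions_inter_cons (u := [b]) (v := [a]) hab rfl hz with h | h | ⟨h, -⟩
    · exact Or.inl h
    · exact Or.inr h
    · exact absurd (List.head_eq_of_cons_eq h) hab.symm
  suffices y ∈ swapBalls p a b w ∨ y ∈ swapPrefixWords p a b w ∨ y ∈ swapSuffixWords p a b w ∨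
      y ∈ swapCornerWords p a b w by
    simp only [Finset.mem_union, Finset.mem_sdiff]
    by_cases hV : y ∈ swapBalls p a b w
    · exact Or.inl (Or.inl (Or.inl hV))
    · rcases this with h | h | h | h
      · exact absurd h hV
      · exact Or.inl (Or.inl (Or.inr ⟨h, hV⟩))
      · exact Or.inl (Or.inr ⟨h, hV⟩)
      · exact Or.inr h
  rw [Finset.mem_union, Finset.mem_union] at h
  rcases h with (h | h) | h
  · simp only [parallelWords, Finset.mem_union, Finset.mem_image, Finset.mem_product,
      List.nil_append, deletions, Finset.inter_self, Finset.notMem_empty, false_and,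
      exists_false, or_false] at h
    rcases h with ⟨⟨v, z⟩, ⟨hv, hz⟩, rfl⟩ | ⟨⟨v, z⟩, ⟨hv, hz⟩, rfl⟩
    · rcases hcore z hz with rfl | rfl
      · exact Or.inr (Or.inl (hP a (Or.inl rfl) v hv))
      · exact Or.inr (Or.inl (hP b (Or.inr rfl) v hv))
    · rcases hcore z hz with rfl | rfl
      · exact Or.inr (Or.inr (Or.inl (hS a (Or.inl rfl) v hv)))
      · exact Or.inr (Or.inr (Or.inl (hS b (Or.inr rfl) v hv)))
  · have h := crossWords_subset rfl rfl h
    rw [Finset.mem_union] at h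
    rcases h with h | h
    · exact Or.inl (Finset.mem_union_left _ h)
    · have h := crossExtras_nil_subset p w a b h
      rw [Finset.mem_union, Finset.mem_union, Finset.mem_image, Finset.mem_image] at h
      rcases h with (⟨v, hv, rfl⟩ | ⟨v, hv, rfl⟩) | h
      · exact Or.inr (Or.inl (hP a (Or.inl rfl) v hv))
      · exact Or.inr (Or.inr (Or.inl (hS a (Or.inl rfl) v hv)))
      · exact Or.inr (Or.inr (Or.inr (Finset.mem_union_left _ h)))
  · have h := crossWords_subset rfl rfl h
    rw [Finset.mem_union] at h
    rcases h with h | h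
    · exact Or.inl (Finset.mem_union_right _ h)
    · have h := crossExtras_nil_subset p w b a h
      rw [Finset.mem_union, Finset.mem_union, Finset.mem_image, Finset.mem_image] at h
      rcases h with (⟨v, hv, rfl⟩ | ⟨v, hv, rfl⟩) | h
      · exact Or.inr (Or.inl (hP b (Or.inr rfl) v hv))
      · exact Or.inr (Or.inr (Or.inl (hS b (Or.inr rfl) v hv)))
      · exact Or.inr (Or.inr (Or.inr (Finset.mem_union_right _ h)))

theorem card_delSubWords_swap_inter_le {p w : List α} {a b : α} (hab : a ≠ b)
    (hn : 3 ≤ p.length + w.length) :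
    (delSubWords (p ++ a :: b :: w) ∩ delSubWords (p ++ b :: a :: w)).card + Fintype.card α + 2 +
      (if Fintype.card α = 2 then 1 else 0) ≤
      2 * (1 + (p.length + w.length + 1) * (Fintype.card α - 1)) + 2 * (p.length + w.length) := by
  have h0 := (Finset.card_le_card (delSubWords_swap_inter_subset (p := p) (w := w) hab)).trans
    ((Finset.card_union_le _ _).trans (Nat.add_le_add_right ((Finset.card_union_le _ _).trans
      (Nat.add_le_add_right (Finset.card_union_le _ _) _)) _))
  have h1 := card_swapBalls_le p w a b
  have h2 := card_swapCornerWords_le p w a b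
  have hP : p ≠ [] → (swapPrefixWords p a b w \ swapBalls p a b w).card + 2 ≤ 2 * p.length :=
    card_swapPrefixWords_sdiff_le hab
  have hS : w ≠ [] → (swapSuffixWords p a b w \ swapBalls p a b w).card + 2 ≤ 2 * w.length :=
    card_swapSuffixWords_sdiff_le hab
  have hP' : Fintype.card α = 2 → 2 ≤ p.length → _ := fun h h' =>
    card_swapPrefixWords_sdiff_le_of_card_eq_two (p := p) (w := w) h hab h'
  have hS' : Fintype.card α = 2 → 2 ≤ w.length → _ := fun h h' =>
    card_swapSuffixWords_sdiff_le_of_card_eq_two (p := p) (w := w) h hab h'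
  -- If `p` or `w` is empty, two words are lost on the other side only, but there are no corner
  -- words. If both are nonempty, four words are lost and at most two corner words gained. The net
  -- loss is two either way.
  rcases eq_or_ne p [] with hp | hp
  · have e1 : (swapPrefixWords p a b w \ swapBalls p a b w).card = 0 := by
      simp [hp, swapPrefixWords, deletions]
    have e2 : (swapCornerWords p a b w).card = 0 := by
      simp [hp, swapCornerWords]
    have hp' : p.length = 0 := by simp [hp]
    have hw : w ≠ [] := by
      rintro rfl
      simp [hp] at hn
    have hS := hS hw
    split_ifs with hq
    · have hS' := hS' hq (by omega)
      omega
    · omega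
  rcases eq_or_ne w [] with hw | hw
  · have e1 : (swapSuffixWords p a b w \ swapBalls p a b w).card = 0 := by
      simp [hw, swapSuffixWords, deletions]
    have e2 : (swapCornerWords p a b w).card = 0 := by
      simp [hw, swapCornerWords]
    have hw' : w.length = 0 := by simp [hw]
    have hP := hP hp
    split_ifs with hq
    · have hP' := hP' hq (by omega)
      omega
    · omega
  have hP := hP hp
  have hS := hS hw
  -- As the lengths sum to at least three, one of `p`, `w` has length at least two and supplies the
  -- extra binary loss.
  split_ifs with hq
  · have hP' := hP' hq
    have hS' := hS' hq
    omega
  · omega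

theorem card_delSubWords_inter_le {q n : ℕ} (hq : 2 ≤ q) (hα : Fintype.card α = q)
    (h1 : (q : ℤ) + 23 ≤ 2 * n) (h2 : 5 * (q : ℤ) + 19 ≤ (q - 1) * n) {x x' : List α}
    (hx : x.length = n) (hx' : x'.length = n) (hd : 2 ≤ mismatches x x') :
    ((delSubWords x ∩ delSubWords x').card : ℤ) ≤
      2 * q * n - 3 * q - 2 - (if q = 2 then 1 else 0) := by
  obtain ⟨p, a, μ, e, w, b, ν, f, hab, hef, hl, rfl, rfl⟩ := exists_core (hx.trans hx'.symm) hd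
  clear hx' hd
  have hcover := (Finset.card_le_card (delSubWords_inter_subset (p := p) (w := w) hab hef hl)).trans
    ((Finset.card_union_le _ _).trans (Nat.add_le_add_right (Finset.card_union_le _ _) _))
  have hpar := card_parallelWords_le p w hab hef hl
  simp only [List.length_append, List.length_cons] at hx
  -- The ball size for words of length `n - 1`, rewritten over the integers to remove the truncated
  -- `q - 1`.
  have hball : ∀ k : ℕ, k + 1 = n →
      ((1 + k * (q - 1) : ℕ) : ℤ) = q * n - q - n + 2 := by
    rintro k rfl
    obtain ⟨r, rfl⟩ := Nat.exists_eq_add_of_le hq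
    rw [show 2 + r - 1 = r + 1 by omega]
    push_cast
    ring
  have hδ : (0 : ℤ) ≤ (if q = 2 then 1 else 0) ∧ (if q = 2 then 1 else 0) ≤ (1 : ℤ) := by
    split_ifs <;> simp
  by_cases e1 : μ ++ [e] = b :: ν <;> by_cases e2 : ν ++ [f] = a :: μ
  · have c1 := card_crossWords_le_of_eq (p := p) (a := a) (f := f) (w := w) hl e1
    have c2 := card_crossWords_le_of_eq (p := p) (a := b) (f := e) (w := w) hl.symm e2
    by_cases hμν : μ = ν
    · subst hμν
      cases μ with
      | nil =>
        simp only [List.nil_append, List.cons.injEq, and_true] at e1 e2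
        subst e1 e2
        simp only [List.length_nil] at hx
        have hs := card_delSubWords_swap_inter_le (p := p) (w := w) hab (by omega)
        have hb := hball (p.length + w.length + 1) (by omega)
        rw [hα] at hs
        simp only [List.nil_append]
        generalize 1 + (p.length + w.length + 1) * (q - 1) = B at hs hb
        generalize (delSubWords (p ++ f :: e :: w) ∩ delSubWords (p ++ e :: f :: w)).card = N at hs ⊢
        have hpw : ((p.length : ℤ) + w.length) + 2 = n := by omega
        by_cases hq2 : q = 2
        · rw [if_pos hq2] at hs ⊢
          zify at hs
          linarith
        · rw [if_neg hq2] at hs ⊢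
          zify at hs
          linarith
      -- Comparing first letters in the two shift equations gives `c = b` and `c = a`.
      | cons c μ =>
        simp only [List.cons_append, List.cons.injEq] at e1 e2
        exact absurd (e2.1.symm.trans e1.1) hab
    -- Two balls plus `3 + 3 + 4` words: the comparison needs only `q + 17 ≤ 2n`.
    · have hpar := card_parallelWords_le_four p w hab hef hl hμν
      have hb := hball (p.length + (ν.length + w.length + 1)) (by omega)
      rw [hα] at c1 c2
      rw [hl] at c2
      generalize 1 + (p.length + (ν.length + w.length + 1)) * (q - 1) = B at c1 c2 hb
      have : (delSubWords (p ++ a :: (μ ++ e :: w)) ∩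
          delSubWords (p ++ b :: (ν ++ f :: w))).card ≤ 2 * B + 10 := by omega
      zify at this
      linarith
  -- One ball: the comparison needs only `5q + 14 ≤ (q-1)n`.
  · have c1 := card_crossWords_le_of_eq (p := p) (a := a) (f := f) (w := w) hl e1
    have c2 := card_crossWords_le (hq.trans_eq hα.symm) p b e w hl.symm e2
    have hb := hball (p.length + (ν.length + w.length + 1)) (by omega)
    rw [hα] at c1 c2
    generalize 1 + (p.length + (ν.length + w.length + 1)) * (q - 1) = B at c1 hb
    have : (delSubWords (p ++ a :: (μ ++ e :: w)) ∩
        delSubWords (p ++ b :: (ν ++ f :: w))).card ≤ 2 * n + B + 3 * q + 9 := by omega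
    zify at this
    linarith
  · have c1 := card_crossWords_le (hq.trans_eq hα.symm) p a f w hl e1
    have c2 := card_crossWords_le_of_eq (p := p) (a := b) (f := e) (w := w) hl.symm e2
    have hb := hball (p.length + (μ.length + w.length + 1)) (by omega)
    rw [hα] at c1 c2
    generalize 1 + (p.length + (μ.length + w.length + 1)) * (q - 1) = B at c2 hb
    have : (delSubWords (p ++ a :: (μ ++ e :: w)) ∩
        delSubWords (p ++ b :: (ν ++ f :: w))).card ≤ 2 * n + B + 3 * q + 9 := by omega
    zify at this
    linarith
  -- No ball: the comparison needs only `9q + 19 ≤ 2(q-1)n`.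
  · have c1 := card_crossWords_le (hq.trans_eq hα.symm) p a f w hl e1
    have c2 := card_crossWords_le (hq.trans_eq hα.symm) p b e w hl.symm e2
    rw [hα] at c1 c2
    have : (delSubWords (p ++ a :: (μ ++ e :: w)) ∩
        delSubWords (p ++ b :: (ν ++ f :: w))).card ≤ 2 * n + 6 * q + 16 := by omega
    zify at this
    linarith

end Bounds

/-! ### Lower bounds for a swap at the beginning of the word -/

section Attained

variable {α : Type*} [DecidableEq α] [Fintype α]

theorem le_card_swapBalls (hq : 2 ≤ Fintype.card α) (p w : List α) {a b : α} (hab : a ≠ b) :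
    2 * (1 + (p.length + w.length + 1) * (Fintype.card α - 1)) ≤
      (swapBalls p a b w).card + Fintype.card α := by
  have h := Finset.card_union_add_card_inter (substitutions (p ++ b :: w))
    (substitutions (p ++ a :: w))
  rw [card_substitutions, card_substitutions] at h
  have h2 := card_substitutions_inter_le hq (u := p ++ b :: w) (v := p ++ a :: w) (by simp)
    (by simpa using hab.symm)
  rw [swapBalls]
  simp only [List.length_append, List.length_cons, ← add_assoc] at h
  omega

/-- Both balls and all words `g g v` with `g` one of `a`, `b` and `v` a deletion of `w` are common.
The distance conditions say exactly that the chosen `g g v` lie outside the balls, so the counts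
add. -/
theorem le_card_delSubWords_swap_inter (hq : 2 ≤ Fintype.card α) {a b : α} (hab : a ≠ b)
    {w : List α} {A B : Finset (List α)} (hA : A ⊆ deletions w) (hB : B ⊆ deletions w)
    (hA' : ∀ v ∈ A, 2 ≤ mismatches w (a :: v)) (hB' : ∀ v ∈ B, 2 ≤ mismatches w (b :: v)) :
    2 * (1 + (w.length + 1) * (Fintype.card α - 1)) + A.card + B.card ≤
      (delSubWords (a :: b :: w) ∩ delSubWords (b :: a :: w)).card + Fintype.card α := by
  have hinj : ∀ g : α, Function.Injective (fun v : List α => g :: g :: v) := by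
    intro g v v' h
    simpa using h
  have hnot : ∀ g v, 2 ≤ mismatches w (g :: v) → g :: g :: v ∉ swapBalls [] a b w := by
    intro g v h hmem
    simp only [swapBalls, List.nil_append, Finset.mem_union, mem_substitutions,
      mismatches_cons] at hmem
    omega
  have h1 : Disjoint (swapBalls [] a b w) (A.image (fun v => a :: a :: v)) := by
    rw [Finset.disjoint_right]
    intro y hy
    obtain ⟨v, hv, rfl⟩ := Finset.mem_image.1 hy
    exact hnot a v (hA' v hv)
  have h2 : Disjoint (swapBalls [] a b w ∪ A.image (fun v => a :: a :: v))
      (B.image (fun v => b :: b :: v)) := by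
    rw [Finset.disjoint_right]
    intro y hy
    obtain ⟨v, hv, rfl⟩ := Finset.mem_image.1 hy
    rw [Finset.mem_union, not_or]
    refine ⟨hnot b v (hB' v hv), ?_⟩
    simp [hab]
  have hsub : swapBalls [] a b w ∪ A.image (fun v => a :: a :: v) ∪
      B.image (fun v => b :: b :: v) ⊆
      delSubWords (a :: b :: w) ∩ delSubWords (b :: a :: w) := by
    have hmem : ∀ g, g = a ∨ g = b → ∀ v ∈ deletions w,
        g :: g :: v ∈ delSubWords (a :: b :: w) ∩ delSubWords (b :: a :: w) := by
      intro g hg v hv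
      have hm : mismatches [a, b] [g, g] ≤ 1 ∧ mismatches [b, a] [g, g] ≤ 1 := by
        rcases hg with rfl | rfl <;> simp <;> split_ifs <;> simp
      simp only [mismatches_cons, mismatches_nil_left] at hm
      simp only [Finset.mem_inter, mem_delSubWords, mem_substitutions]
      refine ⟨⟨a :: b :: v, by simp [deletions, hv], by simp, ?_⟩,
        b :: a :: v, by simp [deletions, hv], by simp, ?_⟩
      · simpa using hm.1
      · simpa using hm.2
    intro y hy
    rw [Finset.mem_union, Finset.mem_union, Finset.mem_image, Finset.mem_image] at hy
    rcases hy with (hy | ⟨v, hv, rfl⟩) | ⟨v, hv, rfl⟩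
    · rw [swapBalls, Finset.mem_union] at hy
      rw [Finset.mem_inter, mem_delSubWords, mem_delSubWords]
      rcases hy with hy | hy
      · exact ⟨⟨b :: w, by simp [deletions], hy⟩, b :: w, by simp [deletions], hy⟩
      · exact ⟨⟨a :: w, by simp [deletions], hy⟩, a :: w, by simp [deletions], hy⟩
    · exact hmem a (Or.inl rfl) v (hA hv)
    · exact hmem b (Or.inr rfl) v (hB hv)
  have h3 := Finset.card_le_card hsub
  rw [Finset.card_union_of_disjoint h2, Finset.card_union_of_disjoint h1,
    Finset.card_image_of_injective _ (hinj a), Finset.card_image_of_injective _ (hinj b)] at h3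
  have h4 := le_card_swapBalls hq [] w hab
  simp only [List.length_nil, zero_add] at h4
  omega

/-- The letter `c` differs from both `a` and `b`, so `g g v` lies in the balls only if `v` is the
tail `w`. All other deletions contribute twice, and the chain condition makes them as many as
possible. -/
theorem le_card_delSubWords_swap_inter_of_ne (hq : 2 ≤ Fintype.card α) {a b c : α} (hab : a ≠ b)
    (hca : c ≠ a) (hcb : c ≠ b) {w : List α} (hw : (c :: w).IsChain (· ≠ ·)) :
    2 * (1 + (w.length + 2) * (Fintype.card α - 1)) + 2 * w.length ≤
      (delSubWords (a :: b :: c :: w) ∩ delSubWords (b :: a :: c :: w)).card +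
        Fintype.card α := by
  have hmem : w ∈ deletions (c :: w) := by simp [deletions]
  have hne : ∀ v ∈ (deletions (c :: w)).erase w, 1 ≤ mismatches w v := by
    intro v hv
    rw [Finset.mem_erase] at hv
    have hl := length_of_mem_deletions hv.2
    have := mt (mismatches_eq_zero (x := w) (y := v) (by simpa using hl.symm)).1 hv.1.symm
    omega
  have h := le_card_delSubWords_swap_inter hq hab (w := c :: w)
    (A := (deletions (c :: w)).erase w) (B := (deletions (c :: w)).erase w)
    (Finset.erase_subset _ _) (Finset.erase_subset _ _)
    (fun v hv => by have := hne v hv; simp [hca]; omega)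
    (fun v hv => by have := hne v hv; simp [hcb]; omega)
  rw [Finset.card_erase_of_mem hmem, card_deletions_of_isChain hw] at h
  simp only [List.length_cons, Nat.add_sub_cancel, add_assoc] at h
  simpa [two_mul, add_assoc] using h

/-- Without a third letter, `a a v` also lies in the balls when `v` is at distance one from `w`. At
most one such `v` exists, which costs the extra one. -/
theorem le_card_delSubWords_swap_inter_self (hq : 2 ≤ Fintype.card α) {a b : α} (hab : a ≠ b)
    {w : List α} (hw : (a :: w).IsChain (· ≠ ·)) :
    2 * (1 + (w.length + 2) * (Fintype.card α - 1)) + 2 * w.length ≤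
      (delSubWords (a :: b :: a :: w) ∩ delSubWords (b :: a :: a :: w)).card +
        Fintype.card α + 1 := by
  have hmem : w ∈ deletions (a :: w) := by simp [deletions]
  have hne : ∀ v ∈ (deletions (a :: w)).erase w, 1 ≤ mismatches w v := by
    intro v hv
    rw [Finset.mem_erase] at hv
    have hl := length_of_mem_deletions hv.2
    have := mt (mismatches_eq_zero (x := w) (y := v) (by simpa using hl.symm)).1 hv.1.symm
    omega
  have h := le_card_delSubWords_swap_inter hq hab (w := a :: w)
    (A := ((deletions (a :: w)).erase w) \ suffixShifts a w) (B := (deletions (a :: w)).erase w)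
    (Finset.sdiff_subset.trans (Finset.erase_subset _ _)) (Finset.erase_subset _ _)
    (fun v hv => by
      obtain ⟨hv, hv'⟩ := Finset.mem_sdiff.1 hv
      have h1 := hne v hv
      rw [mem_suffixShifts, mismatches_comm] at hv'
      have : mismatches w v ≠ 1 := fun h => hv' ⟨Finset.mem_of_mem_erase hv, h⟩
      simp
      omega)
    (fun v hv => by have := hne v hv; simp [hab]; omega)
  have h' := Finset.le_card_sdiff (suffixShifts a w) ((deletions (a :: w)).erase w)
  have h'' := card_suffixShifts_le_one a w
  rw [Finset.card_erase_of_mem hmem, card_deletions_of_isChain hw] at h h'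
  simp only [List.length_cons, Nat.add_sub_cancel, add_assoc, Nat.reduceAdd] at h h' ⊢
  omega

end Attained

/-! ### Translation from words as functions on `Fin n` to lists -/

section Functions

theorem ofFn_alternating_succ {α : Type*} (a b : α) (k : ℕ) :
    List.ofFn (alternating a b (k + 1)) = a :: List.ofFn (alternating b a k) := by
  rw [List.ofFn_succ]
  congr 1
  congr 1
  ext i
  simp only [alternating, Fin.val_succ]
  split_ifs <;> first | rfl | omega

theorem isChain_cons_ofFn_alternating {α : Type*} {a b : α} (hab : a ≠ b) (k : ℕ) :
    (b :: List.ofFn (alternating a b k)).IsChain (· ≠ ·) := by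
  induction k generalizing a b with
  | zero => simp
  | succ k ih =>
    rw [ofFn_alternating_succ]
    exact List.IsChain.cons_cons hab.symm (ih hab.symm)

variable {α : Type*} [DecidableEq α]

theorem hammingDist_eq_mismatches {n : ℕ} (x y : Fin n → α) :
    hammingDist x y = mismatches (List.ofFn x) (List.ofFn y) := by
  induction n with
  | zero => simp [hammingDist]
  | succ n ih =>
    rw [List.ofFn_succ, List.ofFn_succ, mismatches_cons, ← ih, hammingDist, hammingDist,
      Fin.card_filter_univ_succ]
    by_cases h : x 0 = y 0 <;> simp [h, add_comm]

/-- A sublist one letter shorter is an order embedding of positions. The case `n = 0` must be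
excluded: there `n - 1` is truncated to `0` and the empty embedding exists, but the empty list has
no deletion. -/
theorem mem_deletions_ofFn {n : ℕ} (hn : 1 ≤ n) {x : Fin n → α} {u : List α} :
    u ∈ deletions (List.ofFn x) ↔ ∃ D : Fin (n - 1) ↪o Fin n, u = List.ofFn (x ∘ D) := by
  rw [mem_deletions_iff_sublist, List.sublist_iff_exists_fin_orderEmbedding_get_eq]
  constructor
  · rintro ⟨⟨f, hf⟩, hl⟩
    have hl' : n - 1 = u.length := by simp at hl; omega
    refine ⟨((Fin.castOrderIso hl').toOrderEmbedding.trans f).trans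
      (Fin.castOrderIso (by simp)).toOrderEmbedding, ?_⟩
    refine List.ext_get (by simp [hl']) fun i h1 h2 => ?_
    rw [hf ⟨i, h1⟩]
    simp
    rfl
  · rintro ⟨D, rfl⟩
    refine ⟨⟨((Fin.castOrderIso (by simp)).toOrderEmbedding.trans D).trans
      (Fin.castOrderIso (by simp)).toOrderEmbedding, fun i => ?_⟩, by simp; omega⟩
    simp
    rfl

variable [Fintype α]

theorem mem_delSubBall_iff {n : ℕ} (hn : 1 ≤ n) {x : Fin n → α} {y : Fin (n - 1) → α} :
    y ∈ delSubBall 1 1 x ↔ List.ofFn y ∈ delSubWords (List.ofFn x) := by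
  simp only [delSubBall, Set.mem_ofPred_eq, mem_delSubWords, mem_deletions_ofFn hn,
    mem_substitutions, hammingDist_eq_mismatches]
  constructor
  · rintro ⟨D, hD⟩
    exact ⟨_, ⟨D, rfl⟩, by simp, hD⟩
  · rintro ⟨_, ⟨D, rfl⟩, -, hD⟩
    exact ⟨D, hD⟩

theorem ncard_delSubBall_inter {n : ℕ} (hn : 1 ≤ n) (x x' : Fin n → α) :
    (delSubBall 1 1 x ∩ delSubBall 1 1 x').ncard =
      (delSubWords (List.ofFn x) ∩ delSubWords (List.ofFn x')).card := by
  rw [← Set.ncard_image_of_injective _ (List.ofFn_injective (α := α) (n := n - 1)),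
    ← Set.ncard_coe_finset]
  congr 1
  ext u
  simp only [Set.mem_image, Set.mem_inter_iff, mem_delSubBall_iff hn, Finset.mem_coe,
    Finset.mem_inter]
  constructor
  · rintro ⟨y, hy, rfl⟩
    exact hy
  · intro hu
    have hl : u.length = n - 1 := by
      obtain ⟨v, hv, hvu⟩ := mem_delSubWords.1 hu.1
      have h1 := length_of_mem_deletions hv
      have h2 := (mem_substitutions.1 hvu).1
      simp at h1
      omega
    refine ⟨fun i => u.get (i.cast hl.symm), ?_⟩
    have : List.ofFn (fun i : Fin (n - 1) => u.get (i.cast hl.symm)) = u :=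
      List.ext_get (by simp [hl]) (by simp)
    exact ⟨by rwa [this], this⟩

end Functions

/-! ### The bound and the extremal pairs for functions on `Fin n` -/

theorem ncard_delSubBall_inter_le {q n : ℕ} (hq : 2 ≤ q) (h1 : (q : ℤ) + 23 ≤ 2 * n)
    (h2 : 5 * (q : ℤ) + 19 ≤ (q - 1) * n) (x x' : Fin n → Fin q) (hd : 2 ≤ hammingDist x x') :
    ((delSubBall 1 1 x ∩ delSubBall 1 1 x').ncard : ℤ) ≤
      2 * q * n - 3 * q - 2 - (if q = 2 then 1 else 0) := by
  rw [ncard_delSubBall_inter (by omega)]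
  exact card_delSubWords_inter_le hq (Fintype.card_fin q) h1 h2 (List.length_ofFn)
    (List.length_ofFn) (by rwa [← hammingDist_eq_mismatches])

theorem extremal_of_three_le {q k : ℕ} [NeZero q] (hq : 3 ≤ q)
    (h1 : (q : ℤ) + 23 ≤ 2 * (5 + k : ℕ)) (h2 : 5 * (q : ℤ) + 19 ≤ (q - 1) * (5 + k : ℕ))
    (x x' : Fin (5 + k) → Fin q)
    (hx : x = Fin.append ![0, 1, 2, 0, 1] (alternating 0 1 k))
    (hx' : x' = Fin.append ![1, 0, 2, 0, 1] (alternating 0 1 k)) :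
    hammingDist x x' = 2 ∧
      ((delSubBall 1 1 x ∩ delSubBall 1 1 x').ncard : ℤ) =
        2 * q * (5 + k : ℕ) - 3 * q - 2 - (if q = 2 then 1 else 0) := by
  have hx₁ : List.ofFn x = 0 :: 1 :: 2 :: 0 :: 1 :: List.ofFn (alternating 0 1 k) := by
    rw [hx, List.ofFn_fin_append]
    simp [List.ofFn_succ]
  have hx₂ : List.ofFn x' = 1 :: 0 :: 2 :: 0 :: 1 :: List.ofFn (alternating 0 1 k) := by
    rw [hx', List.ofFn_fin_append]
    simp [List.ofFn_succ]
  have h01 : (0 : Fin q) ≠ 1 := by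
    simp [Fin.ext_iff, Nat.mod_eq_of_lt (show 1 < q by omega)]
  have h20 : (2 : Fin q) ≠ 0 := by
    simp [Fin.ext_iff, Nat.mod_eq_of_lt (show 2 < q by omega)]
  have h21 : (2 : Fin q) ≠ 1 := by
    simp [Fin.ext_iff, Nat.mod_eq_of_lt (show 2 < q by omega),
      Nat.mod_eq_of_lt (show 1 < q by omega)]
  have hd : hammingDist x x' = 2 := by
    rw [hammingDist_eq_mismatches, hx₁, hx₂]
    simp [h01, h01.symm]
  refine ⟨hd, le_antisymm (ncard_delSubBall_inter_le (by omega) h1 h2 x x' hd.ge) ?_⟩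
  rw [ncard_delSubBall_inter (by omega), hx₁, hx₂]
  have h := le_card_delSubWords_swap_inter_of_ne (by simp; omega) h01 h20 h21
    (w := 0 :: 1 :: List.ofFn (alternating 0 1 k))
    (List.IsChain.cons_cons h20 (List.IsChain.cons_cons h01 (isChain_cons_ofFn_alternating h01 k)))
  rw [Fintype.card_fin, if_neg (by omega)] at *
  simp only [List.length_cons, List.length_ofFn] at h
  generalize (delSubWords (α := Fin q) _ ∩ delSubWords _).card = N at h ⊢
  zify [show 1 ≤ q by omega] at h
  push_cast
  linarith

theorem extremal_of_eq_two {q k : ℕ} [NeZero q] (hq : q = 2)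
    (h1 : (q : ℤ) + 23 ≤ 2 * (4 + k : ℕ)) (h2 : 5 * (q : ℤ) + 19 ≤ (q - 1) * (4 + k : ℕ))
    (x x' : Fin (4 + k) → Fin q)
    (hx : x = Fin.append ![0, 1, 0, 1] (alternating 0 1 k))
    (hx' : x' = Fin.append ![1, 0, 0, 1] (alternating 0 1 k)) :
    hammingDist x x' = 2 ∧
      ((delSubBall 1 1 x ∩ delSubBall 1 1 x').ncard : ℤ) =
        2 * q * (4 + k : ℕ) - 3 * q - 2 - (if q = 2 then 1 else 0) := by
  have hx₁ : List.ofFn x = 0 :: 1 :: 0 :: 1 :: List.ofFn (alternating 0 1 k) := by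
    rw [hx, List.ofFn_fin_append]
    simp [List.ofFn_succ]
  have hx₂ : List.ofFn x' = 1 :: 0 :: 0 :: 1 :: List.ofFn (alternating 0 1 k) := by
    rw [hx', List.ofFn_fin_append]
    simp [List.ofFn_succ]
  have h01 : (0 : Fin q) ≠ 1 := by
    simp [Fin.ext_iff, Nat.mod_eq_of_lt (show 1 < q by omega)]
  have hd : hammingDist x x' = 2 := by
    rw [hammingDist_eq_mismatches, hx₁, hx₂]
    simp [h01, h01.symm]
  refine ⟨hd, le_antisymm (ncard_delSubBall_inter_le (by omega) h1 h2 x x' hd.ge) ?_⟩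
  rw [ncard_delSubBall_inter (by omega), hx₁, hx₂]
  have h := le_card_delSubWords_swap_inter_self (by simp; omega) h01
    (w := 1 :: List.ofFn (alternating 0 1 k))
    (List.IsChain.cons_cons h01 (isChain_cons_ofFn_alternating h01 k))
  rw [Fintype.card_fin] at h
  rw [if_pos hq]
  simp only [List.length_cons, List.length_ofFn] at h
  generalize (delSubWords (α := Fin q) _ ∩ delSubWords _).card = N at h ⊢
  zify [show 1 ≤ q by omega] at h
  push_cast
  linarith

theorem theorem1 (q n : ℕ) [NeZero q] (hq : 2 ≤ q)
    (hn : max (((q : ℝ) + 23) / 2) ((5 * (q : ℝ) + 19) / ((q : ℝ) - 1)) ≤ (n : ℝ)) :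
    -- the upper bound
    (∀ x x' : Fin n → Fin q, 2 ≤ hammingDist x x' →
      ((delSubBall 1 1 x ∩ delSubBall 1 1 x').ncard : ℤ) ≤
        2 * q * n - 3 * q - 2 - (if q = 2 then 1 else 0)) ∧
    -- the bound is attained by words at distance exactly two
    (∃ x x' : Fin n → Fin q, hammingDist x x' = 2 ∧
      ((delSubBall 1 1 x ∩ delSubBall 1 1 x').ncard : ℤ) =
        2 * q * n - 3 * q - 2 - (if q = 2 then 1 else 0)) ∧
    -- an extremal pair for `q ≥ 3`; the length `5 + (n - 5)` is `n`
    (3 ≤ q → ∀ x x' : Fin (5 + (n - 5)) → Fin q,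
      x = Fin.append ![0, 1, 2, 0, 1] (alternating 0 1 (n - 5)) →
      x' = Fin.append ![1, 0, 2, 0, 1] (alternating 0 1 (n - 5)) →
      hammingDist x x' = 2 ∧
      ((delSubBall 1 1 x ∩ delSubBall 1 1 x').ncard : ℤ) =
        2 * q * n - 3 * q - 2 - (if q = 2 then 1 else 0)) ∧
    -- an extremal pair for `q = 2`; the length `4 + (n - 4)` is `n`
    (q = 2 → ∀ x x' : Fin (4 + (n - 4)) → Fin q,
      x = Fin.append ![0, 1, 0, 1] (alternating 0 1 (n - 4)) →
      x' = Fin.append ![1, 0, 0, 1] (alternating 0 1 (n - 4)) →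
      hammingDist x x' = 2 ∧
      ((delSubBall 1 1 x ∩ delSubBall 1 1 x').ncard : ℤ) =
        2 * q * n - 3 * q - 2 - (if q = 2 then 1 else 0)) := by
  have hq' : (0 : ℝ) < (q : ℝ) - 1 := by
    have : (2 : ℝ) ≤ q := by exact_mod_cast hq
    linarith
  have h1 : (q : ℤ) + 23 ≤ 2 * n := by
    have h := (le_max_left _ _).trans hn
    rw [div_le_iff₀ two_pos] at h
    have : (q : ℝ) + 23 ≤ 2 * n := by linarith
    exact_mod_cast this
  have h2 : 5 * (q : ℤ) + 19 ≤ (q - 1) * n := by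
    have h := (le_max_right _ _).trans hn
    rw [div_le_iff₀ hq'] at h
    have : 5 * (q : ℝ) + 19 ≤ (q - 1) * n := by linarith
    exact_mod_cast this
  -- The subtractions are not truncated, since `q + 23 ≤ 2n` and `q ≥ 2` give `n ≥ 13`.
  have e5 : 5 + (n - 5) = n := by omega
  have e4 : 4 + (n - 4) = n := by omega
  have h5 : 3 ≤ q → ∀ x x' : Fin (5 + (n - 5)) → Fin q, _ → _ → _ := fun h x x' hx hx' =>
    extremal_of_three_le (k := n - 5) h (by rwa [e5]) (by rwa [e5]) x x' hx hx'
  have h4 : q = 2 → ∀ x x' : Fin (4 + (n - 4)) → Fin q, _ → _ → _ := fun h x x' hx hx' =>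
    extremal_of_eq_two (k := n - 4) h (by rwa [e4]) (by rwa [e4]) x x' hx hx'
  have transfer : ∀ {m : ℕ}, m = n → (∃ x x' : Fin m → Fin q, hammingDist x x' = 2 ∧
      ((delSubBall 1 1 x ∩ delSubBall 1 1 x').ncard : ℤ) =
        2 * q * m - 3 * q - 2 - (if q = 2 then 1 else 0)) →
      ∃ x x' : Fin n → Fin q, hammingDist x x' = 2 ∧
      ((delSubBall 1 1 x ∩ delSubBall 1 1 x').ncard : ℤ) =
        2 * q * n - 3 * q - 2 - (if q = 2 then 1 else 0) := by
    rintro m rfl h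
    exact h
  refine ⟨ncard_delSubBall_inter_le hq h1 h2, ?_, ?_, ?_⟩
  · rcases hq.eq_or_lt with h | h
    · exact transfer e4 ⟨_, _, h4 h.symm _ _ rfl rfl⟩
    · exact transfer e5 ⟨_, _, h5 h _ _ rfl rfl⟩
  · intro h x x' hx hx'
    have := h5 h x x' hx hx'
    -- Only the integer cast of the length is rewritten; the words keep their type.
    rwa [Int.natCast_inj.2 e5] at this
  · intro h x x' hx hx'
    have := h4 h x x' hx hx'
    rwa [Int.natCast_inj.2 e4] at this
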